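/- Let $K$ be a field of characteristic $0$, complete with respect to a nontrivial nonarchimedean absolute value $|\cdot|$ (for instance a complete discretely valued field of mixed characteristic $(0,p)$), and let $n\ge 0$. A subset $C\subseteq\mathbb{R}^n$ is rational polyhedral if its indicator function $\delta_C$ ($0$ on $C$, $+\infty$ off $C$) is the maximum of finitely many functions $\mathbb{R}^n\to\mathbb{R}\cup\{+\infty\}$, each of which is either an affine functional $a_1x_1+\cdots+a_nx_n+b$ with integer $a_i,b$, or the sum of such a functional and the indicator function of a closed halfspace $\{a'_1x_1+\cdots+a'_nx_n\le b'\}$ with integers $a'_i,b'$, the $a'_i$ not all zero. Let $S\subseteq(0,+\infty)^n$ be a nonempty log-RP subset, i.e. the image of $S$ under the coordinatewise logarithm is rational polyhedral. For $R\in(0,+\infty)^n$ and $J\in\mathbb{Z}^n$ put $R^J=\prod_i r_i^{j_i}$. Let $A_K(S)$ be the generalized polyannulus $\{(|t_1|,\dots,|t_n|)\in S\}$, with ring of functions $$\Gamma(A_K(S),\mathcal{O})=\Big\{\sum_{J\in\mathbb{Z}^n}c_JT^J : c_J\in K,\ \lim_{J\to\infty}|c_J|R^J=0\ (R\in S)\Big\},$$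 and for $R\in S$ let $|\sum_J c_JT^J|_R=\sup_J|c_J|R^J$ be the Gauss norm. Let $\mathcal{E}$ be a $\nabla$-module on $A_K(S)$, i.e. a finite projective $\Gamma(A_K(S),\mathcal{O})$-module $M=\Gamma(A_K(S),\mathcal{E})$ (equivalently, a locally free coherent sheaf) with an integrable connection, given by commuting additive actions on $M$ of $\partial_i=\partial/\partial t_i$ ($i=1,\dots,n$) satisfying the Leibniz rule. For $R\in S$ let $F_R$ be the completion of $\operatorname{Frac}\Gamma(A_K(S),\mathcal{O})$ under $|\cdot|_R$, with the continuous extensions of the derivations $\partial_i$, and let $V_R=M\otimes_{\Gamma(A_K(S),\mathcal{O})}F_R$ with the induced actions of the $\partial_i$. For a bounded additive operator $D$ on a normed space write $|D|_{\mathrm{sp}}=\lim_{k\to\infty}|D^k|^{1/k}=\inf_{k\ge1}|D^k|^{1/k}$, where $|\cdot|$ is the operator norm; on $V_R$ use the supremum norm of any basis over $F_R$ (the spectral norm does not depend on the basis). The toric-normalized generic radius of convergence is $$T(\mathcal{E},R)=\Big(\max\Big\{1,\ \max_{1\le i\le n}\frac{|\partial_i|_{V_R,\mathrm{sp}}}{|\partial_i|_{F_R,\mathrm{sp}}}\Big\}\Big)^{-1}.$$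 Then for all $A,B\in S$ and $c\in[0,1]$, the point $A^cB^{1-c}=(a_i^cb_i^{1-c})_i$ lies in $S$, and $$T(\mathcal{E},A^cB^{1-c})\ \ge\ T(\mathcal{E},A)^c\,T(\mathcal{E},B)^{1-c}.$$ -/

import Mathlib

open Filter Topology
open scoped TensorProduct NNReal

noncomputable section

namespace GenericRadius

/-- Points of `(0, +∞)^n`. -/
abbrev Polyradius (n : ℕ) : Type := Fin n → Set.Ioi (0 : ℝ)

/-- The monomial `R^J = r_1^{j_1} ⋯ r_n^{j_n}`. -/
def mono {n : ℕ} (R : Polyradius n) (J : Fin n → ℤ) : ℝ := ∏ i, (R i : ℝ) ^ J i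

theorem mono_pos {n : ℕ} (R : Polyradius n) (J : Fin n → ℤ) : 0 < mono R J :=
  Finset.prod_pos fun i _ => zpow_pos (R i).2 _

theorem mono_add {n : ℕ} (R : Polyradius n) (I J : Fin n → ℤ) :
    mono R (I + J) = mono R I * mono R J := by
  simp only [mono, ← Finset.prod_mul_distrib, Pi.add_apply]
  exact Finset.prod_congr rfl fun i _ => zpow_add₀ (ne_of_gt (R i).2) _ _

theorem mono_zero {n : ℕ} (R : Polyradius n) : mono R 0 = 1 := by simp [mono]

theorem mono_single {n : ℕ} (R : Polyradius n) (i : Fin n) : mono R (Pi.single i 1) = R i := by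
  rw [mono, Finset.prod_eq_single i]
  · simp
  · intro j _ hj
    simp [hj]
  · simp

section Ring

variable {K : Type*} [NontriviallyNormedField K] [IsUltrametricDist K] {n : ℕ}

/-- The additive group of formal Laurent series `∑ c_J T^J` with `c_J ∈ K`, `J ∈ ℤ^n`, such that
`|c_J| R^J → 0` along the cofinite filter, for every `R ∈ S`. -/
def seriesSubgroup (K : Type*) [NontriviallyNormedField K] [IsUltrametricDist K] {n : ℕ}
    (S : Set (Polyradius n)) : AddSubgroup ((Fin n → ℤ) → K) where
  carrier := {c | ∀ R ∈ S, Tendsto (fun J => ‖c J‖ * mono R J) cofinite (𝓝 0)}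
  zero_mem' := fun R _ => by simpa using tendsto_const_nhds
  add_mem' := by
    intro a b ha hb R hR
    refine squeeze_zero (fun J => mul_nonneg (norm_nonneg _) (mono_pos R J).le) (fun J => ?_)
      (by simpa using (ha R hR).add (hb R hR))
    rw [← add_mul]
    exact mul_le_mul_of_nonneg_right (norm_add_le _ _) (mono_pos R J).le
  neg_mem' := by
    intro a ha R hR
    simpa using ha R hR

/-- The ring `Γ(A_K(S), 𝒪)` of analytic functions on the generalized polyannulus `A_K(S)`. -/
def Sections (K : Type*) [NontriviallyNormedField K] [IsUltrametricDist K] {n : ℕ}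
    (S : Set (Polyradius n)) : Type _ := seriesSubgroup K S

namespace Sections

variable {S : Set (Polyradius n)}

instance : AddCommGroup (Sections K S) := inferInstanceAs (AddCommGroup (seriesSubgroup K S))

/-- The coefficient `c_J` of `∑ c_J T^J`. -/
def coeff (f : Sections K S) : (Fin n → ℤ) → K := f.1

theorem tendsto (f : Sections K S) {R : Polyradius n} (hR : R ∈ S) :
    Tendsto (fun J => ‖f.coeff J‖ * mono R J) cofinite (𝓝 0) := f.2 R hR

@[ext] theorem ext {f g : Sections K S} (h : ∀ J, f.coeff J = g.coeff J) : f = g :=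
  Subtype.ext (funext h)

@[simp] theorem coeff_zero (J : Fin n → ℤ) : (0 : Sections K S).coeff J = 0 := rfl
@[simp] theorem coeff_add (f g : Sections K S) (J : Fin n → ℤ) :
    (f + g).coeff J = f.coeff J + g.coeff J := rfl

theorem max_of_tendsto {ι : Type*} [Nonempty ι] {a : ι → ℝ} (h0 : ∀ i, 0 ≤ a i)
    (h : Tendsto a cofinite (𝓝 0)) : ∃ i, ∀ j, a j ≤ a i := by
  by_cases hz : ∀ i, a i = 0
  · exact ⟨Classical.arbitrary ι, fun j => by rw [hz, hz]⟩
  · push Not at hz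
    obtain ⟨i, hi⟩ := hz
    have hi' : 0 < a i := lt_of_le_of_ne (h0 i) (Ne.symm hi)
    have hfin : {j | ¬ a j < a i}.Finite := h.eventually (gt_mem_nhds hi')
    obtain ⟨k, hk, hmax⟩ := Set.exists_max_image _ a hfin ⟨i, by simp⟩
    refine ⟨k, fun j => ?_⟩
    by_cases hj : a j < a i
    · exact hj.le.trans (hmax i (by simp))
    · exact hmax j hj

theorem conv_summable [CompleteSpace K] [Nonempty S] (f g : Sections K S) (J : Fin n → ℤ) :
    Summable fun I => f.coeff I * g.coeff (J - I) := by
  obtain ⟨R, hR⟩ := ‹Nonempty S›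
  apply NonarchimedeanAddGroup.summable_of_tendsto_cofinite_zero
  rw [tendsto_zero_iff_norm_tendsto_zero]
  have h1 : Tendsto (fun I => (I, J - I)) (cofinite : Filter (Fin n → ℤ)) cofinite :=
    Function.Injective.tendsto_cofinite fun a b h => (Prod.ext_iff.1 h).1
  have h2 := ((tendsto_mul_cofinite_nhds_zero (f.tendsto hR) (g.tendsto hR)).comp h1).div_const
    (mono R J)
  rw [zero_div] at h2
  refine h2.congr fun I => ?_
  have : mono R J = mono R I * mono R (J - I) := by rw [← mono_add]; congr 1; abel
  have h3 := (mono_pos R I).ne'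
  have h4 := (mono_pos R (J - I)).ne'
  simp only [Function.comp_apply, norm_mul, this]
  field_simp

theorem norm_conv_le (f g : Sections K S) (J : Fin n → ℤ)
    (R : Polyradius n) {ε : ℝ} (hε : 0 ≤ ε)
    (h : ∀ I, (‖f.coeff I‖ * mono R I) * (‖g.coeff (J - I)‖ * mono R (J - I)) ≤ ε) :
    ‖∑' I, f.coeff I * g.coeff (J - I)‖ * mono R J ≤ ε := by
  rw [← le_div_iff₀ (mono_pos R J)]
  refine IsUltrametricDist.norm_tsum_le_of_forall_le_of_nonneg
    (div_nonneg hε (mono_pos R J).le) fun I => ?_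
  rw [le_div_iff₀ (mono_pos R J), norm_mul]
  have : mono R J = mono R I * mono R (J - I) := by rw [← mono_add]; congr 1; abel
  rw [this]
  calc _ = _ := by ring
    _ ≤ ε := h I

/-- Multiplication is the Cauchy product `(f g)_J = ∑_I f_I g_{J - I}`. -/
instance [CompleteSpace K] [Nonempty S] : Mul (Sections K S) where
  mul f g := ⟨fun J => ∑' I, f.coeff I * g.coeff (J - I), by
    intro R hR
    rw [Metric.tendsto_nhds]
    intro ε hε
    have h1 := tendsto_mul_cofinite_nhds_zero (f.tendsto hR) (g.tendsto hR)
    have hfin : {p : (Fin n → ℤ) × (Fin n → ℤ) | ¬ (‖f.coeff p.1‖ * mono R p.1) *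
        (‖g.coeff p.2‖ * mono R p.2) < ε / 2}.Finite := h1.eventually (gt_mem_nhds (half_pos hε))
    refine (hfin.image fun p => p.1 + p.2).subset fun J hJ => ?_
    by_contra hcon
    apply hJ
    have : ‖∑' I, f.coeff I * g.coeff (J - I)‖ * mono R J ≤ ε / 2 := by
      refine norm_conv_le f g J R (half_pos hε).le fun I => ?_
      by_contra hI
      exact hcon ⟨(I, J - I), fun hh => hI hh.le, by simp⟩
    have h0 : 0 ≤ ‖∑' I, f.coeff I * g.coeff (J - I)‖ * mono R J :=
      mul_nonneg (norm_nonneg _) (mono_pos R J).le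
    simp only [Set.mem_ofPred_eq, Real.dist_eq, sub_zero, abs_of_nonneg h0]
    linarith⟩

theorem coeff_mul [CompleteSpace K] [Nonempty S] (f g : Sections K S) (J : Fin n → ℤ) :
    (f * g).coeff J = ∑' I, f.coeff I * g.coeff (J - I) := rfl

open Classical in
instance : One (Sections K S) where
  one := ⟨Pi.single 0 1, by
    intro R hR
    refine tendsto_nhds_of_eventually_eq ?_
    refine (Set.finite_singleton (0 : Fin n → ℤ)).subset fun J hJ => ?_
    by_contra h
    exact hJ (by
      have : J ≠ 0 := h
      simp [Pi.single_apply, this])⟩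

open Classical in
theorem coeff_one (J : Fin n → ℤ) : (1 : Sections K S).coeff J = if J = 0 then 1 else 0 := by
  change (Pi.single 0 1 : (Fin n → ℤ) → K) J = _
  simp [Pi.single_apply]

section CommRing
variable [CompleteSpace K] [Nonempty S]

theorem mul_comm' (f g : Sections K S) : f * g = g * f := by
  ext J
  rw [coeff_mul, coeff_mul, ← (Equiv.subLeft J).tsum_eq]
  refine tsum_congr fun I => ?_
  simp [mul_comm]

theorem one_mul' (f : Sections K S) : 1 * f = f := by
  ext J
  rw [coeff_mul, tsum_eq_single 0]
  · simp [coeff_one]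
  · intro I hI
    simp [coeff_one, hI]

theorem left_distrib' (f g h : Sections K S) : f * (g + h) = f * g + f * h := by
  ext J
  simp only [coeff_mul, coeff_add, mul_add]
  exact (conv_summable f g J).tsum_add (conv_summable f h J)

theorem mul_assoc' (f g h : Sections K S) : f * g * h = f * (g * h) := by
  ext J
  have hs : Summable fun p : (Fin n → ℤ) × (Fin n → ℤ) =>
      f.coeff p.2 * (g.coeff (p.1 - p.2) * h.coeff (J - p.1)) := by
    obtain ⟨R, hR⟩ := ‹Nonempty S›
    obtain ⟨I0, hI0⟩ := max_of_tendsto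
      (fun I => mul_nonneg (norm_nonneg (h.coeff I)) (mono_pos R I).le) (h.tendsto hR)
    apply NonarchimedeanAddGroup.summable_of_tendsto_cofinite_zero
    rw [tendsto_zero_iff_norm_tendsto_zero]
    have h1 : Tendsto (fun p : (Fin n → ℤ) × (Fin n → ℤ) => (p.2, p.1 - p.2))
        cofinite cofinite := by
      refine Function.Injective.tendsto_cofinite fun a b hab => ?_
      obtain ⟨h1, h2⟩ := Prod.ext_iff.1 hab
      simp only at h1 h2
      rw [h1] at h2
      exact Prod.ext (sub_left_injective h2) h1
    have h2 := (((tendsto_mul_cofinite_nhds_zero (f.tendsto hR) (g.tendsto hR)).comp h1).mul_const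
      (‖h.coeff I0‖ * mono R I0)).div_const (mono R J)
    rw [zero_mul, zero_div] at h2
    refine squeeze_zero (fun _ => norm_nonneg _) (fun p => ?_) h2
    have e : mono R J = mono R p.2 * mono R (p.1 - p.2) * mono R (J - p.1) := by
      rw [← mono_add, ← mono_add]; congr 1; abel
    rw [le_div_iff₀ (mono_pos R J), e, norm_mul, norm_mul]
    calc _ = (‖f.coeff p.2‖ * mono R p.2) * (‖g.coeff (p.1 - p.2)‖ * mono R (p.1 - p.2)) *
          (‖h.coeff (J - p.1)‖ * mono R (J - p.1)) := by ring
      _ ≤ _ := mul_le_mul_of_nonneg_left (hI0 _)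
        (mul_nonneg (mul_nonneg (norm_nonneg _) (mono_pos _ _).le)
          (mul_nonneg (norm_nonneg _) (mono_pos _ _).le))
  calc (f * g * h).coeff J
      = ∑' I, ∑' L, f.coeff L * (g.coeff (I - L) * h.coeff (J - I)) := by
        rw [coeff_mul]
        refine tsum_congr fun I => ?_
        rw [coeff_mul, ← tsum_mul_right]
        exact tsum_congr fun L => mul_assoc _ _ _
    _ = ∑' L, ∑' I, f.coeff L * (g.coeff (I - L) * h.coeff (J - I)) :=
        Summable.tsum_comm (f := fun L I => f.coeff L * (g.coeff (I - L) * h.coeff (J - I)))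
          ((Equiv.prodComm _ _).summable_iff.1 hs)
    _ = (f * (g * h)).coeff J := by
        rw [coeff_mul]
        refine tsum_congr fun L => ?_
        rw [coeff_mul, tsum_mul_left]
        congr 1
        refine ((Equiv.addRight L).tsum_eq _).symm.trans (tsum_congr fun I => ?_)
        simp only [Equiv.coe_addRight, add_sub_cancel_right]
        rw [sub_sub, add_comm L]

instance : CommRing (Sections K S) where
  __ := (inferInstance : AddCommGroup (Sections K S))
  __ := (inferInstance : Mul (Sections K S))
  __ := (inferInstance : One (Sections K S))
  left_distrib := left_distrib'
  right_distrib f g h := by rw [mul_comm', left_distrib', mul_comm' h, mul_comm' h]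
  zero_mul f := by ext J; simp [coeff_mul]
  mul_zero f := by ext J; simp [coeff_mul]
  mul_assoc := mul_assoc'
  one_mul := one_mul'
  mul_one f := by rw [mul_comm', one_mul']
  mul_comm := mul_comm'


/-- The Gauss norm `|∑ c_J T^J|_R = sup_J |c_J| R^J`. -/
def gaussNorm (R : S) (f : Sections K S) : ℝ := ⨆ J, ‖f.coeff J‖ * mono R.1 J

theorem exists_gaussNorm (R : S) (f : Sections K S) :
    ∃ I, gaussNorm R f = ‖f.coeff I‖ * mono R.1 I ∧
      ∀ J, ‖f.coeff J‖ * mono R.1 J ≤ ‖f.coeff I‖ * mono R.1 I := by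
  obtain ⟨I, hI⟩ := max_of_tendsto
    (fun J => mul_nonneg (norm_nonneg (f.coeff J)) (mono_pos R.1 J).le) (f.tendsto R.2)
  exact ⟨I, le_antisymm (ciSup_le hI) (le_ciSup (f := fun J => ‖f.coeff J‖ * mono R.1 J)
    ⟨_, by rintro _ ⟨J, rfl⟩; exact hI J⟩ I), hI⟩

theorem le_gaussNorm (R : S) (f : Sections K S) (J : Fin n → ℤ) :
    ‖f.coeff J‖ * mono R.1 J ≤ gaussNorm R f := by
  obtain ⟨I, h, hI⟩ := exists_gaussNorm R f
  rw [h]; exact hI J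

theorem gaussNorm_nonneg (R : S) (f : Sections K S) : 0 ≤ gaussNorm R f :=
  (mul_nonneg (norm_nonneg (f.coeff 0)) (mono_pos R.1 0).le).trans (le_gaussNorm R f 0)

theorem gaussNorm_zero (R : S) : gaussNorm R (0 : Sections K S) = 0 := by simp [gaussNorm]

theorem eq_zero_of_gaussNorm (R : S) {f : Sections K S} (h : gaussNorm R f = 0) : f = 0 := by
  ext J
  have h1 := le_gaussNorm R f J
  rw [h] at h1
  have h2 := nonpos_of_mul_nonpos_left h1 (mono_pos R.1 J)
  simpa using h2

theorem gaussNorm_add (R : S) (f g : Sections K S) :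
    gaussNorm R (f + g) ≤ max (gaussNorm R f) (gaussNorm R g) := by
  refine ciSup_le fun J => ?_
  rw [coeff_add]
  have hm := (mono_pos R.1 J).le
  rcases le_max_iff.1 (IsUltrametricDist.norm_add_le_max (f.coeff J) (g.coeff J)) with h | h
  · exact ((mul_le_mul_of_nonneg_right h hm).trans (le_gaussNorm R f J)).trans (le_max_left _ _)
  · exact ((mul_le_mul_of_nonneg_right h hm).trans (le_gaussNorm R g J)).trans (le_max_right _ _)

theorem gaussNorm_one (R : S) : gaussNorm R (1 : Sections K S) = 1 := by
  refine le_antisymm (ciSup_le fun J => ?_) ?_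
  · by_cases h : J = 0
    · simp [coeff_one, h, mono_zero]
    · simp [coeff_one, h]
  · simpa [coeff_one, mono_zero] using le_gaussNorm R (1 : Sections K S) 0

/-- Among the monomials computing the Gauss norm there is a lexicographically smallest one. -/
theorem exists_lex_min (R : S) {f : Sections K S} (hf : f ≠ 0) :
    ∃ I, gaussNorm R f = ‖f.coeff I‖ * mono R.1 I ∧
      ∀ J, toLex J < toLex I → ‖f.coeff J‖ * mono R.1 J < gaussNorm R f := by
  have hpos : 0 < gaussNorm R f :=
    lt_of_le_of_ne (gaussNorm_nonneg R f) fun h => hf (eq_zero_of_gaussNorm R h.symm)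
  have hfin : {J | ¬ ‖f.coeff J‖ * mono R.1 J < gaussNorm R f}.Finite :=
    (f.tendsto R.2).eventually (gt_mem_nhds hpos)
  obtain ⟨I0, h0, _⟩ := exists_gaussNorm R f
  obtain ⟨I, hI, hmin⟩ := Set.exists_min_image _ (fun J => toLex J) hfin ⟨I0, by simp [h0]⟩
  refine ⟨I, le_antisymm (not_lt.1 hI) (le_gaussNorm R f I), fun J hJ => ?_⟩
  by_contra hc
  exact absurd (hmin J hc) (not_le.2 hJ)

theorem gaussNorm_mul (R : S) (f g : Sections K S) :
    gaussNorm R (f * g) = gaussNorm R f * gaussNorm R g := by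
  by_cases hf : f = 0
  · simp [hf, gaussNorm_zero]
  by_cases hg : g = 0
  · simp [hg, gaussNorm_zero]
  refine le_antisymm (ciSup_le fun J => norm_conv_le f g J R.1
    (mul_nonneg (gaussNorm_nonneg R f) (gaussNorm_nonneg R g)) fun I =>
      mul_le_mul (le_gaussNorm R f I) (le_gaussNorm R g _)
        (mul_nonneg (norm_nonneg _) (mono_pos _ _).le) (gaussNorm_nonneg R f)) ?_
  obtain ⟨I, hI, hI'⟩ := exists_lex_min R hf
  obtain ⟨J, hJ, hJ'⟩ := exists_lex_min R hg
  have hfp : 0 < gaussNorm R f :=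
    lt_of_le_of_ne (gaussNorm_nonneg R f) fun h => hf (eq_zero_of_gaussNorm R h.symm)
  have hgp : 0 < gaussNorm R g :=
    lt_of_le_of_ne (gaussNorm_nonneg R g) fun h => hg (eq_zero_of_gaussNorm R h.symm)
  set a : (Fin n → ℤ) → K := fun L => f.coeff L * g.coeff (I + J - L) with ha
  have key : ∀ L, ‖a L‖ * mono R.1 (I + J) =
      (‖f.coeff L‖ * mono R.1 L) * (‖g.coeff (I + J - L)‖ * mono R.1 (I + J - L)) := by
    intro L
    have : mono R.1 (I + J) = mono R.1 L * mono R.1 (I + J - L) := by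
      rw [← mono_add]; congr 1; abel
    rw [ha, norm_mul, this]; ring
  have hmain : ‖a I‖ * mono R.1 (I + J) = gaussNorm R f * gaussNorm R g := by
    rw [key, hI, hJ, add_sub_cancel_left]
  have hlt : ∀ L, L ≠ I → ‖a L‖ < ‖a I‖ := by
    intro L hL
    refine lt_of_mul_lt_mul_right ?_ (mono_pos R.1 (I + J)).le
    rw [hmain, key]
    rcases lt_or_gt_of_ne (fun h => hL (toLex.injective h) : toLex L ≠ toLex I) with h | h
    · exact mul_lt_mul_of_lt_of_le_of_nonneg_of_pos (hI' L h) (le_gaussNorm R g _)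
        (mul_nonneg (norm_nonneg _) (mono_pos _ _).le) hgp
    · have h2 : toLex (I + J - L) < toLex J := by
        rw [toLex_sub, toLex_add, sub_lt_iff_lt_add, add_comm]
        exact add_lt_add_right h _
      exact (mul_le_mul_of_nonneg_right (le_gaussNorm R f L)
        (mul_nonneg (norm_nonneg _) (mono_pos _ _).le)).trans_lt
          (mul_lt_mul_of_pos_left (hJ' _ h2) hfp)
  have hs : Summable a := conv_summable f g (I + J)
  have hup := hs.update I 0
  have hdec : (f * g).coeff (I + J) = a I + ∑' L, Function.update a I 0 L := by
    rw [coeff_mul, hs.tsum_eq_add_tsum_ite I]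
    congr 1
    exact tsum_congr fun L => by simp [Function.update_apply]
  have hIp : 0 < ‖a I‖ := by
    refine pos_of_mul_pos_left (hmain ▸ mul_pos hfp hgp) (mono_pos R.1 (I + J)).le
  have hrest : ‖∑' L, Function.update a I 0 L‖ < ‖a I‖ := by
    obtain ⟨L0, hL0⟩ := max_of_tendsto (a := fun L => ‖Function.update a I 0 L‖)
      (fun L => norm_nonneg _) (by simpa using hup.tendsto_cofinite_zero.norm)
    refine (IsUltrametricDist.norm_tsum_le_of_forall_le_of_nonneg (norm_nonneg _) hL0).trans_lt ?_
    by_cases h : L0 = I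
    · simpa [h] using hIp
    · simpa [h] using hlt L0 h
  have : ‖(f * g).coeff (I + J)‖ = ‖a I‖ := by
    rw [hdec, IsUltrametricDist.norm_add_eq_max_of_norm_ne_norm hrest.ne', max_eq_left hrest.le]
  rw [← hmain, ← this]
  exact le_gaussNorm R (f * g) (I + J)

/-- The Gauss norm `|·|_R` as a (multiplicative) valuation on `Γ(A_K(S), 𝒪)`. -/
def gaussValuation (R : S) : Valuation (Sections K S) ℝ≥0 where
  toFun f := ⟨gaussNorm R f, gaussNorm_nonneg R f⟩
  map_zero' := NNReal.eq (gaussNorm_zero R)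
  map_one' := NNReal.eq (gaussNorm_one R)
  map_mul' f g := NNReal.eq (gaussNorm_mul R f g)
  map_add_le_max' f g := gaussNorm_add R f g

instance : Nontrivial (Sections K S) :=
  ⟨⟨1, 0, fun h => one_ne_zero (α := K) (by simpa [coeff_one] using congrArg (coeff · 0) h)⟩⟩

instance : IsDomain (Sections K S) :=
  have : NoZeroDivisors (Sections K S) := ⟨by
    intro f g h
    have h1 := gaussNorm_mul (Classical.arbitrary S) f g
    rw [h, gaussNorm_zero] at h1
    exact (mul_eq_zero.1 h1.symm).imp (eq_zero_of_gaussNorm _) (eq_zero_of_gaussNorm _)⟩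
  NoZeroDivisors.to_isDomain _

/-- `∂/∂t_i`, sending `∑ c_J T^J` to `∑ j_i c_J T^{J - e_i}`. -/
def partialFun (i : Fin n) (f : Sections K S) : Sections K S :=
  ⟨fun J => ((J i + 1 : ℤ) : K) * f.coeff (J + Pi.single i 1), by
    intro R hR
    have h1 : Tendsto (fun J : Fin n → ℤ => J + Pi.single i 1) cofinite cofinite :=
      (add_left_injective _).tendsto_cofinite
    have h2 := ((f.tendsto hR).comp h1).div_const (R i : ℝ)
    rw [zero_div] at h2
    refine squeeze_zero (fun J => mul_nonneg (norm_nonneg _) (mono_pos R J).le) (fun J => ?_) h2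
    have hp : (0 : ℝ) < R i := (R i).2
    rw [le_div_iff₀ hp, Function.comp_apply, mono_add, mono_single, norm_mul]
    have hk : 0 ≤ ‖f.coeff (J + Pi.single i 1)‖ * (mono R J * R i) :=
      mul_nonneg (norm_nonneg _) (mul_nonneg (mono_pos R J).le hp.le)
    calc _ = ‖((J i + 1 : ℤ) : K)‖ * (‖f.coeff (J + Pi.single i 1)‖ * (mono R J * R i)) := by ring
      _ ≤ _ := mul_le_of_le_one_left hk (IsUltrametricDist.norm_intCast_le_one K _)⟩

theorem coeff_partialFun (i : Fin n) (f : Sections K S) (J : Fin n → ℤ) :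
    (partialFun i f).coeff J = ((J i + 1 : ℤ) : K) * f.coeff (J + Pi.single i 1) := rfl

theorem partialFun_mul (i : Fin n) (f g : Sections K S) :
    partialFun i (f * g) = f * partialFun i g + g * partialFun i f := by
  ext J
  rw [coeff_partialFun, coeff_add, mul_comm g, coeff_mul, coeff_mul, coeff_mul]
  have e : ∑' I, (partialFun i f).coeff I * g.coeff (J - I) =
      ∑' I : Fin n → ℤ, ((I i : ℤ) : K) * f.coeff I * g.coeff (J + Pi.single i 1 - I) := by
    refine Eq.trans (tsum_congr fun I => ?_)
      ((Equiv.addRight (Pi.single i 1 : Fin n → ℤ)).tsum_eq _)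
    rw [coeff_partialFun, Equiv.coe_addRight, add_sub_add_right_eq_sub]
    simp
  have hs : Summable fun I : Fin n → ℤ =>
      ((I i : ℤ) : K) * f.coeff I * g.coeff (J + Pi.single i 1 - I) := by
    have := (Equiv.subRight (Pi.single i 1 : Fin n → ℤ)).summable_iff.2
      (conv_summable (partialFun i f) g J)
    refine this.congr fun I => ?_
    simp only [Function.comp_apply, coeff_partialFun, Equiv.subRight_apply]
    congr 2
    · simp
    · simp
    · abel
  rw [e, ← (conv_summable f (partialFun i g) J).tsum_add hs, ← tsum_mul_left]
  refine tsum_congr fun I => ?_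
  rw [coeff_partialFun, show J - I + Pi.single i 1 = J + Pi.single i 1 - I by abel]
  simp only [Pi.sub_apply]
  push_cast
  ring

/-- The derivation `∂/∂t_i` of `Γ(A_K(S), 𝒪)`. -/
def partialDeriv (i : Fin n) : Derivation ℤ (Sections K S) (Sections K S) :=
  Derivation.mk' (AddMonoidHom.toIntLinearMap
    { toFun := partialFun i
      map_zero' := by ext J; simp [coeff_partialFun]
      map_add' := fun f g => by ext J; simp [coeff_partialFun, mul_add] })
    fun f g => partialFun_mul i f g

theorem gaussNorm_partialDeriv (R : S) (i : Fin n) (f : Sections K S) :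
    gaussNorm R (partialDeriv i f) ≤ (R.1 i : ℝ)⁻¹ * gaussNorm R f := by
  have hp : (0 : ℝ) < R.1 i := (R.1 i).2
  refine ciSup_le fun J => ?_
  rw [inv_mul_eq_div, le_div_iff₀ hp]
  change ‖((J i + 1 : ℤ) : K) * f.coeff (J + Pi.single i 1)‖ * mono R.1 J * R.1 i ≤ _
  refine le_trans ?_ (le_gaussNorm R f (J + Pi.single i 1))
  rw [mono_add, mono_single, norm_mul]
  have hk : 0 ≤ ‖f.coeff (J + Pi.single i 1)‖ * (mono R.1 J * R.1 i) :=
    mul_nonneg (norm_nonneg _) (mul_nonneg (mono_pos R.1 J).le hp.le)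
  calc _ = ‖((J i + 1 : ℤ) : K)‖ * (‖f.coeff (J + Pi.single i 1)‖ * (mono R.1 J * R.1 i)) := by ring
    _ ≤ _ := mul_le_of_le_one_left hk (IsUltrametricDist.norm_intCast_le_one K _)

end CommRing
end Sections

section Fraction

/-- The unique extension of a derivation of a domain to its fraction field, by the quotient rule
`D (a / b) = (b D a - a D b) / b ^ 2`. -/
def fractionDeriv {A : Type*} [CommRing A] [IsDomain A] (D : Derivation ℤ A A)
    (x : FractionRing A) : FractionRing A :=
  let p := IsLocalization.sec (nonZeroDivisors A) x
  algebraMap A (FractionRing A) (p.2 * D p.1 - p.1 * D p.2) /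
    algebraMap A (FractionRing A) p.2 ^ 2

theorem fractionDeriv_div {A : Type*} [CommRing A] [IsDomain A] (D : Derivation ℤ A A)
    (a b : A) (hb : b ≠ 0) :
    fractionDeriv D (algebraMap A (FractionRing A) a / algebraMap A (FractionRing A) b) =
      algebraMap A (FractionRing A) (b * D a - a * D b) / algebraMap A (FractionRing A) b ^ 2 := by
  set x := algebraMap A (FractionRing A) a / algebraMap A (FractionRing A) b with hx
  set p := IsLocalization.sec (nonZeroDivisors A) x with hp
  have hinj := IsFractionRing.injective A (FractionRing A)
  have hp2 : (p.2 : A) ≠ 0 := nonZeroDivisors.ne_zero p.2.2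
  have hb' : algebraMap A (FractionRing A) b ≠ 0 := fun h => hb (hinj (by simpa using h))
  have hp' : algebraMap A (FractionRing A) p.2 ≠ 0 := fun h => hp2 (hinj (h.trans (map_zero _).symm))
  have h1 : x * algebraMap A (FractionRing A) p.2 = algebraMap A (FractionRing A) p.1 :=
    IsLocalization.sec_spec (nonZeroDivisors A) x
  have h2 : a * p.2 = p.1 * b := by
    apply hinj
    rw [map_mul, map_mul, ← h1, hx]
    field_simp
  have h3 : a * D p.2 + p.2 * D a = p.1 * D b + b * D p.1 := by
    have := congrArg D h2
    simpa [Derivation.leibniz] using this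
  change algebraMap A (FractionRing A) (p.2 * D p.1 - p.1 * D p.2) /
    algebraMap A (FractionRing A) p.2 ^ 2 = _
  rw [div_eq_div_iff (pow_ne_zero 2 hp') (pow_ne_zero 2 hb'), ← map_pow, ← map_pow, ← map_mul,
    ← map_mul]
  congr 1
  linear_combination (p.2 * b : A) * (-h3) + (D b * p.2 + b * D p.2) * h2

end Fraction

section Field

variable [CompleteSpace K] {S : Set (Polyradius n)} [Nonempty S]

theorem nonZeroDivisors_le_primeCompl (R : S) :
    nonZeroDivisors (Sections K S) ≤ (Sections.gaussValuation (K := K) R).supp.primeCompl := by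
  intro f hf h
  have h0 : Sections.gaussValuation R f = 0 := h
  have h1 : Sections.gaussNorm R f = 0 := congrArg (fun z : ℝ≥0 => (z : ℝ)) h0
  exact nonZeroDivisors.ne_zero hf (Sections.eq_zero_of_gaussNorm R h1)

/-- The extension of the Gauss norm `|·|_R` to an absolute value on `Frac Γ(A_K(S), 𝒪)`. -/
def gaussAbs (K : Type*) [NontriviallyNormedField K] [IsUltrametricDist K] [CompleteSpace K]
    {S : Set (Polyradius n)} [Nonempty S] (R : S) :
    AbsoluteValue (FractionRing (Sections K S)) ℝ :=
  let v : Valuation (FractionRing (Sections K S)) ℝ≥0 :=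
    (Sections.gaussValuation (K := K) R).extendToLocalization (nonZeroDivisors_le_primeCompl R)
      (FractionRing (Sections K S))
  { toFun := fun x => (v x : ℝ)
    map_mul' := fun x y => by simp
    nonneg' := fun x => (v x).2
    eq_zero' := fun x => by simp
    add_le' := fun x y => by
      have := v.map_add x y
      calc ((v (x + y) : ℝ≥0) : ℝ) ≤ (max (v x) (v y) : ℝ≥0) := by exact_mod_cast this
        _ ≤ _ := by
          rw [NNReal.coe_max]
          exact max_le (le_add_of_nonneg_right (v y).2) (le_add_of_nonneg_left (v x).2) }

theorem gaussAbs_algebraMap (R : S) (f : Sections K S) :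
    gaussAbs K R (algebraMap _ _ f) = Sections.gaussNorm R f :=
  congrArg (fun z : ℝ≥0 => (z : ℝ))
    (Valuation.extendToLocalization_apply_map_apply _ (nonZeroDivisors_le_primeCompl R)
      (FractionRing (Sections K S)) f)

theorem gaussAbs_fractionDeriv (R : S) (i : Fin n) (x : FractionRing (Sections K S)) :
    gaussAbs K R (fractionDeriv (Sections.partialDeriv i) x) ≤
      (R.1 i : ℝ)⁻¹ * gaussAbs K R x := by
  obtain ⟨a, b, hb, rfl⟩ := IsFractionRing.div_surjective (A := Sections K S) x
  have hb0 : b ≠ 0 := nonZeroDivisors.ne_zero hb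
  have hbp : 0 < Sections.gaussNorm R b := lt_of_le_of_ne (Sections.gaussNorm_nonneg R b)
    fun h => hb0 (Sections.eq_zero_of_gaussNorm R h.symm)
  have hr : (0 : ℝ) < R.1 i := (R.1 i).2
  rw [fractionDeriv_div _ _ _ hb0, map_div₀, map_div₀, map_pow, gaussAbs_algebraMap,
    gaussAbs_algebraMap, gaussAbs_algebraMap, div_le_iff₀ (pow_pos hbp 2)]
  have e : (R.1 i : ℝ)⁻¹ * (Sections.gaussNorm R a / Sections.gaussNorm R b) *
      Sections.gaussNorm R b ^ 2 =
        (R.1 i : ℝ)⁻¹ * (Sections.gaussNorm R a * Sections.gaussNorm R b) := by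
    field_simp
  rw [e, sub_eq_add_neg, ← mul_neg, ← map_neg]
  refine (Sections.gaussNorm_add R _ _).trans (max_le ?_ ?_)
  · rw [Sections.gaussNorm_mul]
    calc _ ≤ Sections.gaussNorm R b * ((R.1 i : ℝ)⁻¹ * Sections.gaussNorm R a) :=
          mul_le_mul_of_nonneg_left (Sections.gaussNorm_partialDeriv R i a) hbp.le
      _ = _ := by ring
  · rw [Sections.gaussNorm_mul]
    have h1 : Sections.gaussNorm R (-b) = Sections.gaussNorm R b :=
      congrArg NNReal.toReal ((Sections.gaussValuation R).map_neg b)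
    calc _ ≤ Sections.gaussNorm R a * ((R.1 i : ℝ)⁻¹ * Sections.gaussNorm R (-b)) :=
          mul_le_mul_of_nonneg_left (Sections.gaussNorm_partialDeriv R i _)
            (Sections.gaussNorm_nonneg R a)
      _ = _ := by rw [h1]; ring

/-- The complete field `F_R`: the completion of `Frac Γ(A_K(S), 𝒪)` under `|·|_R`. -/
def CompletedField (K : Type*) [NontriviallyNormedField K] [IsUltrametricDist K] [CompleteSpace K]
    {S : Set (Polyradius n)} [Nonempty S] (R : S) : Type _ :=
  (gaussAbs K R).Completion

namespace CompletedField

instance (R : S) : NormedField (CompletedField K R) :=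
  inferInstanceAs (NormedField (gaussAbs K R).Completion)

instance (R : S) : CompleteSpace (CompletedField K R) :=
  inferInstanceAs (CompleteSpace (gaussAbs K R).Completion)

/-- The canonical embedding of `Frac Γ(A_K(S), 𝒪)` into `F_R`. -/
def ofFrac (R : S) : FractionRing (Sections K S) →+* CompletedField K R :=
  (UniformSpace.Completion.coeRingHom (α := WithAbs (gaussAbs K R))).comp
    (WithAbs.equiv (gaussAbs K R)).symm.toRingHom

instance (R : S) : Algebra (Sections K S) (CompletedField K R) :=
  ((ofFrac R).comp (algebraMap (Sections K S) (FractionRing (Sections K S)))).toAlgebra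

theorem fractionDeriv_add {A : Type*} [CommRing A] [IsDomain A] (D : Derivation ℤ A A)
    (x y : FractionRing A) :
    fractionDeriv D (x + y) = fractionDeriv D x + fractionDeriv D y := by
  obtain ⟨a, b, hb, rfl⟩ := IsFractionRing.div_surjective (A := A) x
  obtain ⟨c, d, hd, rfl⟩ := IsFractionRing.div_surjective (A := A) y
  have hinj := IsFractionRing.injective A (FractionRing A)
  have hb0 : b ≠ 0 := nonZeroDivisors.ne_zero hb
  have hd0 : d ≠ 0 := nonZeroDivisors.ne_zero hd
  have hb' : algebraMap A (FractionRing A) b ≠ 0 := fun h => hb0 (hinj (by simpa using h))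
  have hd' : algebraMap A (FractionRing A) d ≠ 0 := fun h => hd0 (hinj (by simpa using h))
  rw [div_add_div _ _ hb' hd', ← map_mul, ← map_mul, ← map_mul, ← map_add,
    fractionDeriv_div _ _ _ (mul_ne_zero hb0 hd0), fractionDeriv_div _ _ _ hb0,
    fractionDeriv_div _ _ _ hd0]
  simp only [Derivation.leibniz, map_add, map_sub, map_mul, smul_eq_mul]
  field_simp
  ring

theorem fractionDeriv_mul {A : Type*} [CommRing A] [IsDomain A] (D : Derivation ℤ A A)
    (x y : FractionRing A) :
    fractionDeriv D (x * y) = x * fractionDeriv D y + y * fractionDeriv D x := by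
  obtain ⟨a, b, hb, rfl⟩ := IsFractionRing.div_surjective (A := A) x
  obtain ⟨c, d, hd, rfl⟩ := IsFractionRing.div_surjective (A := A) y
  have hinj := IsFractionRing.injective A (FractionRing A)
  have hb0 : b ≠ 0 := nonZeroDivisors.ne_zero hb
  have hd0 : d ≠ 0 := nonZeroDivisors.ne_zero hd
  have hb' : algebraMap A (FractionRing A) b ≠ 0 := fun h => hb0 (hinj (by simpa using h))
  have hd' : algebraMap A (FractionRing A) d ≠ 0 := fun h => hd0 (hinj (by simpa using h))
  rw [div_mul_div_comm, ← map_mul, ← map_mul,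
    fractionDeriv_div _ _ _ (mul_ne_zero hb0 hd0), fractionDeriv_div _ _ _ hb0,
    fractionDeriv_div _ _ _ hd0]
  simp only [Derivation.leibniz, map_add, map_sub, map_mul, smul_eq_mul]
  field_simp
  ring

theorem fractionDeriv_algebraMap {A : Type*} [CommRing A] [IsDomain A] (D : Derivation ℤ A A)
    (a : A) : fractionDeriv D (algebraMap A (FractionRing A) a) =
      algebraMap A (FractionRing A) (D a) := by
  have := fractionDeriv_div D a 1 one_ne_zero
  simpa using this

/-- `∂/∂t_i` on `Frac Γ(A_K(S), 𝒪)`, as a bounded additive map for `|·|_R`. -/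
def partialFrac (R : S) (i : Fin n) :
    NormedAddGroupHom (WithAbs (gaussAbs K R)) (WithAbs (gaussAbs K R)) where
  toFun x := WithAbs.toAbs _ (fractionDeriv (Sections.partialDeriv i) x.ofAbs)
  map_add' x y := by
    rw [WithAbs.ofAbs_add, fractionDeriv_add, WithAbs.toAbs_add]
  bound' := ⟨(R.1 i : ℝ)⁻¹, fun x => gaussAbs_fractionDeriv R i x.ofAbs⟩

/-- The derivation `∂_i = ∂/∂t_i` of `F_R`, extended from `Frac Γ(A_K(S), 𝒪)` by continuity. -/
def partialHom (R : S) (i : Fin n) :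
    NormedAddGroupHom (CompletedField K R) (CompletedField K R) :=
  (partialFrac R i).completion

theorem partialHom_mul (R : S) (i : Fin n) (x y : CompletedField K R) :
    partialHom R i (x * y) = x * partialHom R i y + y * partialHom R i x := by
  have hc : Continuous (partialHom (K := K) R i) := (partialHom R i).continuous
  have hclosed : IsClosed {p : CompletedField K R × CompletedField K R |
      partialHom R i (p.1 * p.2) = p.1 * partialHom R i p.2 + p.2 * partialHom R i p.1} :=
    isClosed_eq (hc.comp (continuous_fst.mul continuous_snd))
      ((continuous_fst.mul (hc.comp continuous_snd)).add
        (continuous_snd.mul (hc.comp continuous_fst)))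
  refine UniformSpace.Completion.induction_on₂ (α := WithAbs (gaussAbs K R))
    (β := WithAbs (gaussAbs K R)) x y hclosed ?_
  · intro a b
    have h : partialFrac R i (a * b) = a * partialFrac R i b + b * partialFrac R i a := by
      apply WithAbs.ofAbs_injective
      exact fractionDeriv_mul _ _ _
    let φ : WithAbs (gaussAbs K R) →+* CompletedField K R :=
      UniformSpace.Completion.coeRingHom (α := WithAbs (gaussAbs K R))
    have hφ : ∀ z, partialHom R i (φ z) = φ (partialFrac R i z) := fun z =>
      NormedAddGroupHom.completion_coe (partialFrac R i) z
    change partialHom R i (φ a * φ b) = φ a * partialHom R i (φ b) + φ b * partialHom R i (φ a)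
    rw [← RingHom.map_mul, hφ, hφ, hφ, h, RingHom.map_add, RingHom.map_mul, RingHom.map_mul]

theorem partialHom_algebraMap (R : S) (i : Fin n) (f : Sections K S) :
    partialHom R i (algebraMap _ (CompletedField K R) f) =
      algebraMap _ (CompletedField K R) (Sections.partialDeriv i f) := by
  change (partialFrac R i).completion ((WithAbs.toAbs (gaussAbs K R) _ : WithAbs (gaussAbs K R)) :
    UniformSpace.Completion (WithAbs (gaussAbs K R))) = _
  rw [NormedAddGroupHom.completion_coe]
  change ((WithAbs.toAbs _ (fractionDeriv _ (algebraMap _ _ f)) : WithAbs (gaussAbs K R)) :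
    UniformSpace.Completion (WithAbs (gaussAbs K R))) = _
  rw [fractionDeriv_algebraMap]
  rfl

end CompletedField
end Field

section Nabla

variable [CompleteSpace K] {S : Set (Polyradius n)} [Nonempty S]

/-- An integrable connection on a `Γ(A_K(S), 𝒪)`-module `M`. A locally free coherent sheaf on the
(affinoid, or quasi-Stein) space `A_K(S)` is the same thing as a finite projective module
`M = Γ(A_K(S), ℰ)`, so a `∇`-module on `A_K(S)` is a finite projective `M` with this structure. As `Ω^1` is free on
`dt_1, …, dt_n`, a connection `∇ : M → M ⊗ Ω^1` is written `∇ m = ∑ D_i(m) ⊗ dt_i`, where the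
`D_i` are additive and satisfy the Leibniz rule with respect to `∂/∂t_i` (they are then `K`-linear,
as `∂/∂t_i` kills `K`); integrability means that the `D_i` commute. -/
structure IntegrableConnection (K : Type*) [NontriviallyNormedField K] [IsUltrametricDist K]
    [CompleteSpace K] {n : ℕ} (S : Set (Polyradius n)) [Nonempty S] (M : Type*) [AddCommGroup M]
    [Module (Sections K S) M] where
  /-- The action of `∂/∂t_i` on `M`. -/
  D : Fin n → M →+ M
  leibniz : ∀ (i : Fin n) (f : Sections K S) (m : M),
    D i (f • m) = Sections.partialDeriv i f • m + f • D i m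
  integrable : ∀ (i j : Fin n) (m : M), D i (D j m) = D j (D i m)

/-- The operator norm of `T : V → V` for a norm `p` on `V`. -/
def opNorm {V : Type*} (p : V → ℝ) (T : V → V) : ℝ :=
  sInf {c : ℝ | 0 ≤ c ∧ ∀ x, p (T x) ≤ c * p x}

/-- The spectral norm `inf_{k ≥ 1} |T^k|^{1/k}` (equal to `lim_k |T^k|^{1/k}` for bounded
additive `T`). -/
def specNorm {V : Type*} (p : V → ℝ) (T : V → V) : ℝ :=
  ⨅ k : ℕ, opNorm p (T^[k + 1]) ^ (1 / ((k : ℝ) + 1))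

/-- The supremum norm on a vector space with respect to a finite basis. -/
def supNorm {F V ι : Type*} [NormedField F] [AddCommGroup V] [Module F V] [Fintype ι]
    (b : Module.Basis ι F V) (x : V) : ℝ := ‖b.equivFun x‖

namespace IntegrableConnection

variable {M : Type*} [AddCommGroup M] [Module (Sections K S) M]

/-- The action `∂_i (a ⊗ m) = ∂_i a ⊗ m + a ⊗ ∂_i m` on `V = F_R ⊗ M`. -/
def baseChange (E : IntegrableConnection K S M) (R : S) (i : Fin n) :
    (CompletedField K R ⊗[Sections K S] M) →+ (CompletedField K R ⊗[Sections K S] M) :=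
  TensorProduct.liftAddHom
    { toFun := fun a =>
        { toFun := fun m => CompletedField.partialHom R i a ⊗ₜ m + a ⊗ₜ E.D i m
          map_zero' := by simp
          map_add' := fun m m' => by simp only [TensorProduct.tmul_add, map_add]; abel }
      map_zero' := by ext m; simp
      map_add' := fun a a' => by
        ext m
        simp only [map_add, TensorProduct.add_tmul, AddMonoidHom.coe_mk, ZeroHom.coe_mk,
          AddMonoidHom.add_apply]
        abel }
    (fun f a m => by
      simp only [AddMonoidHom.coe_mk, ZeroHom.coe_mk, E.leibniz, Algebra.smul_def,
        CompletedField.partialHom_mul, CompletedField.partialHom_algebraMap,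
        TensorProduct.add_tmul, TensorProduct.tmul_add]
      simp only [mul_comm a, ← Algebra.smul_def, TensorProduct.tmul_smul, TensorProduct.smul_tmul']
      abel)

/-- The scale `max_i max {1, |∂_i|_{V,sp} / |∂_i|_{F,sp}}` of the differential module
`V = F_R ⊗ M` over `F = F_R`. The norm on `V` is the supremum norm of a basis; the spectral norm
does not depend on the choice of the basis. -/
def scale (E : IntegrableConnection K S M) [Module.Finite (Sections K S) M] (R : S) : ℝ :=
  max 1 (⨆ i : Fin n,
    specNorm (supNorm (Module.finBasis (CompletedField K R)
        (CompletedField K R ⊗[Sections K S] M))) (E.baseChange R i) /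
      specNorm (fun x : CompletedField K R => ‖x‖) (CompletedField.partialHom R i))

/-- The toric-normalized generic radius of convergence `T(ℰ, R)`. -/
def genericRadius (E : IntegrableConnection K S M) [Module.Finite (Sections K S) M] (R : S) : ℝ :=
  (E.scale R)⁻¹

end IntegrableConnection
end Nabla
end Ring

section Polyhedral

variable {n : ℕ}

/-- The affine functional `a_1 x_1 + ⋯ + a_n x_n + b` with integer coefficients. -/
def integralAffine (a : Fin n → ℤ) (b : ℤ) (x : Fin n → ℝ) : ℝ := ∑ i, (a i : ℝ) * x i + b

open Classical in
/-- The indicator function `δ_C`, which is `0` on `C` and `+∞` off `C`. -/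
def indicatorFun (C : Set (Fin n → ℝ)) (x : Fin n → ℝ) : WithTop ℝ := if x ∈ C then 0 else ⊤

/-- An integral generalized affine functional: an integral affine functional, or the sum of an
integral affine functional and the indicator function of a closed halfspace
`a_1 x_1 + ⋯ + a_n x_n ≤ b` with `a_1, …, a_n, b` integers and the `a_i` not all zero. -/
def IsIntegralGenAffine (l : (Fin n → ℝ) → WithTop ℝ) : Prop :=
  (∃ (a : Fin n → ℤ) (b : ℤ), ∀ x, l x = (integralAffine a b x : ℝ)) ∨
  ∃ (a : Fin n → ℤ) (b : ℤ) (a' : Fin n → ℤ) (b' : ℤ), a' ≠ 0 ∧ ∀ x,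
    l x = (integralAffine a b x : ℝ) + indicatorFun {y | ∑ i, (a' i : ℝ) * y i ≤ b'} x

/-- `f` is the maximum of finitely many integral generalized affine functionals. -/
def IsIntegralPolyhedral (f : (Fin n → ℝ) → WithTop ℝ) : Prop :=
  ∃ (m : ℕ) (l : Fin m → (Fin n → ℝ) → WithTop ℝ), (∀ j, IsIntegralGenAffine (l j)) ∧
    ∀ x, IsGreatest (Set.range fun j => l j x) (f x)

/-- `C` is rational polyhedral if `δ_C` is integral polyhedral. -/
def IsRationalPolyhedral (C : Set (Fin n → ℝ)) : Prop := IsIntegralPolyhedral (indicatorFun C)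

/-- The coordinatewise logarithm. -/
def logMap (R : Polyradius n) : Fin n → ℝ := fun i => Real.log (R i)

/-- Log-(rational polyhedral) subsets of `(0, +∞)^n`. -/
def IsLogRP (S : Set (Polyradius n)) : Prop := IsRationalPolyhedral (logMap '' S)

/-- The point `A^c B^{1-c}`. -/
def interp (A B : Polyradius n) (c : ℝ) : Polyradius n := fun i =>
  ⟨(A i : ℝ) ^ c * (B i : ℝ) ^ (1 - c),
    mul_pos (Real.rpow_pos_of_pos (A i).2 _) (Real.rpow_pos_of_pos (B i).2 _)⟩

theorem logMap_interp (A B : Polyradius n) (c : ℝ) :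
    logMap (interp A B c) = c • logMap A + (1 - c) • logMap B := by
  funext i
  have hA : (0 : ℝ) < A i := (A i).2
  have hB : (0 : ℝ) < B i := (B i).2
  simp only [logMap, interp, Pi.add_apply, Pi.smul_apply, smul_eq_mul]
  rw [Real.log_mul (Real.rpow_pos_of_pos hA _).ne' (Real.rpow_pos_of_pos hB _).ne',
    Real.log_rpow hA, Real.log_rpow hB]

theorem logMap_injective : Function.Injective (logMap (n := n)) := by
  intro A B h
  funext i
  exact Subtype.ext (Real.log_injOn_pos (A i).2 (B i).2 (congrFun h i))

theorem indicatorFun_ne_top {C : Set (Fin n → ℝ)} {x : Fin n → ℝ} :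
    indicatorFun C x ≠ ⊤ ↔ x ∈ C := by
  by_cases h : x ∈ C <;> simp [indicatorFun, h]

theorem IsIntegralGenAffine.ne_top {l : (Fin n → ℝ) → WithTop ℝ} (hl : IsIntegralGenAffine l)
    {x y : Fin n → ℝ} (hx : l x ≠ ⊤) (hy : l y ≠ ⊤) {c : ℝ} (h0 : 0 ≤ c) (h1 : c ≤ 1) :
    l (c • x + (1 - c) • y) ≠ ⊤ := by
  rcases hl with ⟨a, b, h⟩ | ⟨a, b, a', b', -, h⟩
  · rw [h]; exact WithTop.coe_ne_top
  · rw [h, WithTop.add_ne_top] at hx hy ⊢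
    refine ⟨WithTop.coe_ne_top, ?_⟩
    have hx := indicatorFun_ne_top.1 hx.2
    have hy := indicatorFun_ne_top.1 hy.2
    refine indicatorFun_ne_top.2 ?_
    simp only [Set.mem_ofPred_eq] at hx hy ⊢
    have e : ∑ i, (a' i : ℝ) * (c • x + (1 - c) • y) i =
        c * ∑ i, (a' i : ℝ) * x i + (1 - c) * ∑ i, (a' i : ℝ) * y i := by
      rw [Finset.mul_sum, Finset.mul_sum, ← Finset.sum_add_distrib]
      refine Finset.sum_congr rfl fun i _ => ?_
      simp only [Pi.add_apply, Pi.smul_apply, smul_eq_mul]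
      ring
    rw [e]
    nlinarith [mul_le_mul_of_nonneg_left hx h0, mul_le_mul_of_nonneg_left hy (sub_nonneg.2 h1)]

/-- A log-RP set contains `A^c B^{1-c}` along with `A` and `B`. -/
theorem IsLogRP.interp_mem {S : Set (Polyradius n)} (hS : IsLogRP S) {A B : Polyradius n}
    (hA : A ∈ S) (hB : B ∈ S) {c : ℝ} (hc : c ∈ Set.Icc (0 : ℝ) 1) : interp A B c ∈ S := by
  obtain ⟨m, l, hl, hmax⟩ := hS
  have hfin : ∀ R ∈ S, ∀ j, l j (logMap R) ≠ ⊤ := fun R hR j =>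
    ne_top_of_le_ne_top (indicatorFun_ne_top.2 (Set.mem_image_of_mem _ hR))
      ((hmax (logMap R)).2 ⟨j, rfl⟩)
  obtain ⟨j, hj⟩ := (hmax (logMap (interp A B c))).1
  have h : logMap (interp A B c) ∈ logMap '' S := by
    rw [← indicatorFun_ne_top, ← hj, logMap_interp]
    exact (hl j).ne_top (hfin A hA j) (hfin B hB j) hc.1 hc.2
  obtain ⟨R, hR, hRe⟩ := h
  exact logMap_injective hRe ▸ hR

end Polyhedral

end GenericRadius

end

/-!
The matrix entries of the iterates `∂_i^k` on `M` are analytic functions on `A_K(S)`, and the Gauss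
norm of an analytic function is log-convex in `R` (Hadamard's three-circle inequality,
`gaussNorm_interp_le`). So the growth of these entries at `A` and `B` bounds their growth at
`A^c B^{1-c}`, and the growth of the entries determines the spectral norms up to the contribution
of the base field.

The module `M` need not be free: entries are taken in a dual basis `m_j`, `l_j` with
`x = ∑ l_j(x) m_j`, which exists as `M` is finite projective. Every `l_j` extends to `F_R ⊗ M`,
where a norm bound on `∂_i^k` gives one on `l_s(∂_i^k m_j)`
(`IntegrableConnection.exists_gaussNorm_le_of_hasGrowth`). Conversely, bounds `O(θ^k)` on these
entries and on `∂_i^k` on `F_R` give the bound `O(θ^k)` on `F_R ⊗ M` by the Leibniz formula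
(`IntegrableConnection.hasGrowth_of_gaussNorm_le`). The condition on `F_R` is what the maximum
with `1` in the definition of the scale accounts for.

It remains to normalize. On `F_R` the operator `∂_i^k` has norm exactly `|k!| r_i^{-k}`: it is
attained at `t_i^k`, and the upper bound passes from analytic functions to quotients by induction
on `k`, then to `F_R` by density. Hence `|∂_i|_{F_R,sp} = ω r_i^{-1}` with `ω = inf_k |k!|^{1/k} > 0`
(`specNorm_partialHom`), which is log-linear in `R`. Dividing by it and letting the auxiliary growth
rates decrease to the spectral norms gives the log-convexity of the scale
(`IntegrableConnection.scale_interp_le`), the inverse of the generic radius.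
-/

noncomputable section

namespace GenericRadius

/-! ### Spectral norms and geometric growth of iterates -/

section Spectral

variable {V : Type*} {p : V → ℝ} {T : V → V}

theorem opNorm_nonneg : 0 ≤ opNorm p T := Real.sInf_nonneg fun _ hc => hc.1

theorem opNorm_le {c : ℝ} (hc : 0 ≤ c) (h : ∀ x, p (T x) ≤ c * p x) : opNorm p T ≤ c :=
  csInf_le ⟨0, fun _ hc => hc.1⟩ ⟨hc, h⟩

theorem le_opNorm (hp : ∀ x, 0 ≤ p x) {c : ℝ} (hc : 0 ≤ c) (h : ∀ x, p (T x) ≤ c * p x) (x : V) :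
    p (T x) ≤ opNorm p T * p x := by
  rcases (hp x).eq_or_lt with hx | hx
  · simpa [← hx] using h x
  · rw [← div_le_iff₀ hx]
    exact le_csInf ⟨c, hc, h⟩ fun d hd => (div_le_iff₀ hx).2 (hd.2 x)

/-- The iterates of `T` grow at most geometrically with ratio `θ`: `|T^k| = O(θ^k)`. -/
def HasGrowth (p : V → ℝ) (T : V → V) (θ : ℝ) : Prop :=
  ∃ L : ℝ, 0 ≤ L ∧ ∀ k x, p (T^[k] x) ≤ L * θ ^ k * p x

theorem specNorm_nonneg : 0 ≤ specNorm p T :=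
  Real.iInf_nonneg fun _ => Real.rpow_nonneg opNorm_nonneg _

theorem iterate_le_of_bound {c : ℝ} (hc : 0 ≤ c) (h : ∀ x, p (T x) ≤ c * p x) (k : ℕ) (x : V) :
    p (T^[k] x) ≤ c ^ k * p x := by
  induction k with
  | zero => simp
  | succ k ih =>
    rw [Function.iterate_succ_apply', pow_succ', mul_assoc]
    exact (h _).trans (mul_le_mul_of_nonneg_left ih hc)

/-- A bounded operator grows at most like any ratio larger than its spectral norm. -/
theorem hasGrowth_of_specNorm_lt (hp : ∀ x, 0 ≤ p x) {c : ℝ} (hc : 0 ≤ c)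
    (h : ∀ x, p (T x) ≤ c * p x) {θ : ℝ} (hθ : specNorm p T < θ) : HasGrowth p T θ := by
  have hθ0 : 0 < θ := specNorm_nonneg.trans_lt hθ
  obtain ⟨m, hm⟩ := exists_lt_of_ciInf_lt hθ
  have hN : opNorm p T^[m + 1] ≤ θ ^ (m + 1) := by
    have h1 := pow_le_pow_left₀ (Real.rpow_nonneg opNorm_nonneg _) hm.le (m + 1)
    rwa [← Real.rpow_natCast, ← Real.rpow_mul opNorm_nonneg, Nat.cast_add_one,
      one_div_mul_cancel (by positivity), Real.rpow_one] at h1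
  have hstep : ∀ x, p (T^[m + 1] x) ≤ θ ^ (m + 1) * p x := fun x =>
    (le_opNorm hp (pow_nonneg hc _) (iterate_le_of_bound hc h (m + 1)) x).trans
      (mul_le_mul_of_nonneg_right hN (hp x))
  have hd : 1 ≤ max 1 (c / θ) := le_max_left _ _
  have hd0 : 0 ≤ max 1 (c / θ) := zero_le_one.trans hd
  refine ⟨max 1 (c / θ) ^ (m + 1), pow_nonneg hd0 _, fun k => ?_⟩
  induction k using Nat.strong_induction_on with
  | _ k ih =>
    intro x
    by_cases hk : k < m + 1
    · refine (iterate_le_of_bound hc h k x).trans (mul_le_mul_of_nonneg_right ?_ (hp x))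
      calc c ^ k = (c / θ) ^ k * θ ^ k := by rw [← mul_pow, div_mul_cancel₀ _ hθ0.ne']
        _ ≤ max 1 (c / θ) ^ (m + 1) * θ ^ k := by
          refine mul_le_mul_of_nonneg_right ?_ (pow_nonneg hθ0.le _)
          exact (pow_le_pow_left₀ (div_nonneg hc hθ0.le) (le_max_right _ _) _).trans
            (pow_le_pow_right₀ hd hk.le)
    · obtain ⟨j, rfl⟩ := Nat.exists_eq_add_of_le (not_lt.1 hk)
      rw [Function.iterate_add_apply]
      refine (hstep _).trans ?_
      calc _ ≤ θ ^ (m + 1) * (max 1 (c / θ) ^ (m + 1) * θ ^ j * p x) :=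
            mul_le_mul_of_nonneg_left (ih j (by omega) x) (pow_nonneg hθ0.le _)
        _ = _ := by rw [pow_add θ (m + 1) j]; ring

theorem specNorm_le_of_hasGrowth (hp : ∀ x, 0 ≤ p x) {θ : ℝ} (hθ : 0 ≤ θ)
    (h : HasGrowth p T θ) : specNorm p T ≤ θ := by
  obtain ⟨L, hL0, hL⟩ := h
  have hL1 : 0 < L + 1 := by linarith
  have hlim : Tendsto (fun k : ℕ => (L + 1) ^ (1 / ((k : ℝ) + 1)) * θ) atTop (𝓝 θ) := by
    have h1 : Tendsto (fun k : ℕ => (L + 1) ^ (1 / ((k : ℝ) + 1))) atTop (𝓝 ((L + 1) ^ (0 : ℝ))) :=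
      tendsto_const_nhds.rpow tendsto_one_div_add_atTop_nhds_zero_nat (Or.inl hL1.ne')
    simpa using h1.mul_const θ
  refine ge_of_tendsto' hlim fun k => ?_
  have hk : (0 : ℝ) < (k : ℝ) + 1 := by positivity
  have hop : opNorm p T^[k + 1] ≤ (L + 1) * θ ^ (k + 1) := by
    refine opNorm_le (mul_nonneg hL1.le (pow_nonneg hθ _)) fun x => (hL (k + 1) x).trans ?_
    exact mul_le_mul_of_nonneg_right (mul_le_mul_of_nonneg_right (by linarith) (pow_nonneg hθ _))
      (hp x)
  calc specNorm p T ≤ opNorm p T^[k + 1] ^ (1 / ((k : ℝ) + 1)) :=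
        ciInf_le ⟨0, by rintro _ ⟨j, rfl⟩; exact Real.rpow_nonneg opNorm_nonneg _⟩ k
    _ ≤ ((L + 1) * θ ^ (k + 1)) ^ (1 / ((k : ℝ) + 1)) :=
        Real.rpow_le_rpow opNorm_nonneg hop (by positivity)
    _ = (L + 1) ^ (1 / ((k : ℝ) + 1)) * θ := by
        rw [Real.mul_rpow hL1.le (pow_nonneg hθ _), ← Real.rpow_natCast θ, ← Real.rpow_mul hθ,
          Nat.cast_add_one, mul_one_div_cancel hk.ne', Real.rpow_one]

end Spectral

/-- The Leibniz formula for the iterates of an additive operator over a derivation. -/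
theorem iterate_smul_eq_sum {F V : Type*} [Semiring F] [AddCommMonoid V] [Module F V]
    (d : F →+ F) (T : V →+ V) (h : ∀ a v, T (a • v) = d a • v + a • T v) (k : ℕ) (a : F) (v : V) :
    T^[k] (a • v) =
      ∑ ij ∈ Finset.HasAntidiagonal.antidiagonal k, k.choose ij.1 • (d^[ij.1] a • T^[ij.2] v) := by
  induction k with
  | zero => simp
  | succ k ih =>
    rw [Finset.sum_antidiagonal_choose_succ_nsmul (fun i j => d^[i] a • T^[j] v),
      Function.iterate_succ_apply', ih, map_sum, ← Finset.sum_add_distrib]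
    refine Finset.sum_congr rfl fun ij hij => ?_
    have hij' : ij.1 + ij.2 = k := Finset.HasAntidiagonal.mem_antidiagonal.1 hij
    rw [map_nsmul, h, ← Function.iterate_succ_apply' d, ← Function.iterate_succ_apply' T, nsmul_add,
      add_comm, Nat.choose_symm_of_eq_add hij'.symm]

/-! ### Norms of factorials -/

section Factorial

variable {K : Type*} [NontriviallyNormedField K] [IsUltrametricDist K]

theorem norm_natCast_eq_one_of_coprime {a b : ℕ} (hab : a.Coprime b) (ha : ‖(a : K)‖ < 1) :
    ‖(b : K)‖ = 1 := by
  refine le_antisymm (IsUltrametricDist.norm_natCast_le_one K b) (not_lt.1 fun hb => ?_)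
  obtain ⟨u, v, huv⟩ := Nat.isCoprime_iff_coprime.2 hab
  have h1 : (1 : K) = u * a + v * b := by simpa using (congrArg (Int.cast (R := K)) huv).symm
  have key : ∀ (w : ℤ) (m : ℕ), ‖(m : K)‖ < 1 → ‖(w : K) * m‖ < 1 := fun w m hm => by
    rw [norm_mul]
    exact (mul_le_of_le_one_left (norm_nonneg _)
      (IsUltrametricDist.norm_intCast_le_one K w)).trans_lt hm
  have h2 := (IsUltrametricDist.norm_add_le_max ((u : K) * a) (v * b)).trans_lt
    (max_lt (key u a ha) (key v b hb))
  rw [← h1, norm_one] at h2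
  exact lt_irrefl _ h2

/-- Factorials are not too small: either all of them are units of the valuation ring, or the
absolute value restricts to a `p`-adic one and the `p`-adic valuation of `k!` is at most `k`. -/
theorem exists_pow_le_norm_factorial [CharZero K] :
    ∃ δ : ℝ, 0 < δ ∧ ∀ k : ℕ, δ ^ k ≤ ‖(k.factorial : K)‖ := by
  by_cases hp : ∃ p : ℕ, p.Prime ∧ ‖(p : K)‖ < 1
  · obtain ⟨p, hpp, hlt⟩ := hp
    refine ⟨‖(p : K)‖, norm_pos_iff.2 (Nat.cast_ne_zero.2 hpp.ne_zero), fun k => ?_⟩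
    have : Fact p.Prime := ⟨hpp⟩
    have hu := norm_natCast_eq_one_of_coprime (Nat.coprime_ordCompl hpp k.factorial_ne_zero) hlt
    have hk := Nat.ordProj_mul_ordCompl_eq_self k.factorial p
    rw [← hk, Nat.cast_mul, norm_mul, hu, mul_one, Nat.cast_pow, norm_pow]
    refine pow_le_pow_of_le_one (norm_nonneg _) hlt.le ?_
    rw [Nat.factorization_def _ hpp]
    exact padicValNat_factorial_le p k
  · push Not at hp
    have hunit : ∀ m : ℕ, m ≠ 0 → ‖(m : K)‖ = 1 := by
      intro m
      induction m using Nat.recOnMul with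
      | zero => simp
      | one => simp
      | prime q hq =>
        exact fun _ => le_antisymm (IsUltrametricDist.norm_natCast_le_one K q) (hp q hq)
      | mul a b ha hb =>
        intro h
        rw [Nat.cast_mul, norm_mul, ha (left_ne_zero_of_mul h), hb (right_ne_zero_of_mul h), one_mul]
    exact ⟨1, one_pos, fun k => by rw [one_pow, hunit _ k.factorial_ne_zero]⟩

end Factorial

/-! ### The derivations of the completed fields -/

section Field

variable {K : Type*} [NontriviallyNormedField K] [IsUltrametricDist K] [CompleteSpace K] {n : ℕ}
  {S : Set (Polyradius n)} [Nonempty S]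

theorem coeff_iterate_partialDeriv (i : Fin n) (k : ℕ) (f : Sections K S) (J : Fin n → ℤ) :
    ((Sections.partialDeriv i)^[k] f).coeff J =
      ((∏ s ∈ Finset.range k, (J i + 1 + s) : ℤ) : K) * f.coeff (J + Pi.single i (k : ℤ)) := by
  induction k generalizing f with
  | zero => simp
  | succ k ih =>
    rw [Function.iterate_succ_apply, ih, Finset.prod_range_succ]
    change _ * (Sections.partialFun i f).coeff _ = _
    rw [Sections.coeff_partialFun, add_assoc J, ← Pi.single_add]
    simp only [Pi.add_apply, Pi.single_eq_same]
    push_cast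
    ring

theorem mono_single_natCast (R : Polyradius n) (i : Fin n) (k : ℕ) :
    mono R (Pi.single i (k : ℤ)) = (R i : ℝ) ^ k := by
  rw [mono, Finset.prod_eq_single i]
  · simp
  · intro j _ hj
    simp [hj]
  · simp

/-- The divided powers `∂_i^k / k!` have norm at most `r_i^{-k}` on analytic functions, since
`k!` divides a product of `k` consecutive integers. -/
theorem gaussNorm_iterate_partialDeriv_le (R : S) (i : Fin n) (k : ℕ) (f : Sections K S) :
    Sections.gaussNorm R ((Sections.partialDeriv i)^[k] f) ≤
      ‖(k.factorial : K)‖ * (R.1 i : ℝ)⁻¹ ^ k * Sections.gaussNorm R f := by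
  have hr : (0 : ℝ) < R.1 i := (R.1 i).2
  refine ciSup_le fun J => ?_
  rw [coeff_iterate_partialDeriv]
  obtain ⟨z, hz⟩ := Nat.factorial_coe_dvd_prod k (J i + 1)
  have hle : ‖((∏ s ∈ Finset.range k, (J i + 1 + s) : ℤ) : K)‖ ≤ ‖(k.factorial : K)‖ := by
    rw [hz, Int.cast_mul, norm_mul, Int.cast_natCast]
    exact mul_le_of_le_one_right (norm_nonneg _) (IsUltrametricDist.norm_intCast_le_one K z)
  have hc := Sections.le_gaussNorm R f (J + Pi.single i (k : ℤ))
  rw [mono_add, mono_single_natCast] at hc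
  have hc' : ‖f.coeff (J + Pi.single i (k : ℤ))‖ * mono R.1 J ≤
      (R.1 i : ℝ)⁻¹ ^ k * Sections.gaussNorm R f := by
    rw [inv_pow, inv_mul_eq_div, le_div_iff₀ (pow_pos hr k), mul_assoc]
    exact hc
  rw [norm_mul, mul_assoc, mul_assoc]
  exact mul_le_mul hle hc' (mul_nonneg (norm_nonneg _) (mono_pos _ _).le) (norm_nonneg _)

open Classical in
theorem coeff_natCast (m : ℕ) (J : Fin n → ℤ) :
    (m : Sections K S).coeff J = if J = 0 then (m : K) else 0 := by
  induction m with
  | zero => simp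
  | succ m ih => rw [Nat.cast_succ, Sections.coeff_add, ih, Sections.coeff_one]; split_ifs <;> simp

theorem gaussAbs_add_le_max (R : S) (x y : FractionRing (Sections K S)) :
    gaussAbs K R (x + y) ≤ max (gaussAbs K R x) (gaussAbs K R y) := by
  have h := ((Sections.gaussValuation (K := K) R).extendToLocalization
    (nonZeroDivisors_le_primeCompl R) (FractionRing (Sections K S))).map_add x y
  have h' := NNReal.coe_le_coe.2 h
  rwa [NNReal.coe_max] at h'

namespace CompletedField

instance (R : S) : IsUltrametricDist (CompletedField K R) := by
  refine IsUltrametricDist.isUltrametricDist_of_forall_norm_add_le_max_norm fun x y => ?_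
  refine UniformSpace.Completion.induction_on₂ (α := WithAbs (gaussAbs K R))
    (β := WithAbs (gaussAbs K R)) x y (isClosed_le ?_ ?_) fun a b => ?_
  · exact continuous_norm.comp (continuous_fst.add continuous_snd)
  · exact (continuous_norm.comp continuous_fst).max (continuous_norm.comp continuous_snd)
  · change ‖((a : UniformSpace.Completion (WithAbs (gaussAbs K R))) + b)‖ ≤
      max ‖(a : UniformSpace.Completion (WithAbs (gaussAbs K R)))‖
        ‖(b : UniformSpace.Completion (WithAbs (gaussAbs K R)))‖
    rw [← UniformSpace.Completion.coe_add, UniformSpace.Completion.norm_coe,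
      UniformSpace.Completion.norm_coe, UniformSpace.Completion.norm_coe]
    exact gaussAbs_add_le_max R a.ofAbs b.ofAbs

theorem norm_algebraMap (R : S) (f : Sections K S) :
    ‖algebraMap (Sections K S) (CompletedField K R) f‖ = Sections.gaussNorm R f :=
  (UniformSpace.Completion.norm_coe (E := WithAbs (gaussAbs K R)) _).trans
    (gaussAbs_algebraMap R f)

theorem norm_natCast (R : S) (m : ℕ) : ‖(m : CompletedField K R)‖ = ‖(m : K)‖ := by
  rw [← map_natCast (algebraMap (Sections K S) (CompletedField K R)), norm_algebraMap]
  refine le_antisymm (ciSup_le fun J => ?_) ?_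
  · by_cases h : J = 0
    · simp [coeff_natCast, h, mono_zero]
    · simp [coeff_natCast, h]
  · simpa [coeff_natCast, mono_zero] using Sections.le_gaussNorm R (m : Sections K S) 0

theorem iterate_partialHom_algebraMap (R : S) (i : Fin n) (k : ℕ) (f : Sections K S) :
    (partialHom R i)^[k] (algebraMap _ (CompletedField K R) f) =
      algebraMap _ (CompletedField K R) ((Sections.partialDeriv i)^[k] f) := by
  induction k generalizing f with
  | zero => rfl
  | succ k ih => rw [Function.iterate_succ_apply, partialHom_algebraMap, ih,
      Function.iterate_succ_apply]

/-- Quotients of analytic functions are dense in `F_R`. -/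
theorem induction_div (R : S) {P : CompletedField K R → Prop} (hP : IsClosed {x | P x})
    (h : ∀ f g : Sections K S, g ≠ 0 →
      P (algebraMap _ (CompletedField K R) f / algebraMap _ (CompletedField K R) g))
    (x : CompletedField K R) : P x := by
  refine UniformSpace.Completion.induction_on (α := WithAbs (gaussAbs K R)) x hP fun a => ?_
  obtain ⟨f, g, hg, hfg⟩ := IsFractionRing.div_surjective (A := Sections K S) a.ofAbs
  have := h f g (nonZeroDivisors.ne_zero hg)
  have e : algebraMap (Sections K S) (CompletedField K R) f / algebraMap _ (CompletedField K R) g =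
      ofFrac R a.ofAbs := by
    rw [← hfg, map_div₀]; rfl
  rw [e] at this
  exact this

/-- The divided powers `∂_i^k / k!` have norm at most `r_i^{-k}` on `F_R`. For a quotient
`x = f / g` this follows by induction on `k` from the Leibniz expansion of `∂_i^k (g x)`. -/
theorem norm_iterate_partialHom_le (R : S) (i : Fin n) (k : ℕ) (x : CompletedField K R) :
    ‖(partialHom R i)^[k] x‖ ≤ ‖(k.factorial : K)‖ * (R.1 i : ℝ)⁻¹ ^ k * ‖x‖ := by
  have hr : (0 : ℝ) < R.1 i := (R.1 i).2
  refine induction_div R (P := fun x => ‖(partialHom R i)^[k] x‖ ≤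
    ‖(k.factorial : K)‖ * (R.1 i : ℝ)⁻¹ ^ k * ‖x‖) ?_ (fun f g hg => ?_) x
  · exact isClosed_le (continuous_norm.comp ((partialHom R i).continuous.iterate k))
      (continuous_const.mul continuous_norm)
  set a := algebraMap (Sections K S) (CompletedField K R) f with ha
  set b := algebraMap (Sections K S) (CompletedField K R) g with hb
  have hb0 : 0 < ‖b‖ := by
    rw [hb, norm_algebraMap]
    exact (Sections.gaussNorm_nonneg R g).lt_of_ne
      fun h => hg (Sections.eq_zero_of_gaussNorm R h.symm)
  set y := a / b with hy
  have hby : b * y = a := mul_div_cancel₀ a (norm_pos_iff.1 hb0)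
  have hsec : ∀ (j : ℕ) (f : Sections K S),
      ‖(partialHom R i)^[j] (algebraMap _ (CompletedField K R) f)‖ ≤
        ‖(j.factorial : K)‖ * (R.1 i : ℝ)⁻¹ ^ j * ‖algebraMap _ (CompletedField K R) f‖ := by
    intro j f
    rw [iterate_partialHom_algebraMap, norm_algebraMap, norm_algebraMap]
    exact gaussNorm_iterate_partialDeriv_le R i j f
  induction k using Nat.strong_induction_on with
  | _ k ih =>
    set B : ℝ := ‖(k.factorial : K)‖ * (R.1 i : ℝ)⁻¹ ^ k * ‖a‖ with hB
    have hB0 : 0 ≤ B := by positivity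
    have hleib := iterate_smul_eq_sum (partialHom R i).toAddMonoidHom
      (partialHom R i).toAddMonoidHom (fun u v => by
        simpa [mul_comm, add_comm] using partialHom_mul R i u v) k b y
    rw [smul_eq_mul, hby] at hleib
    rw [← Finset.add_sum_erase _ _
      (show (0, k) ∈ Finset.HasAntidiagonal.antidiagonal k by simp)] at hleib
    have hsum : ‖b * (partialHom R i)^[k] y‖ ≤ B := by
      have hb' : b * (partialHom R i)^[k] y = (partialHom R i)^[k] a -
          ∑ ij ∈ (Finset.HasAntidiagonal.antidiagonal k).erase (0, k),
            k.choose ij.1 • ((partialHom R i)^[ij.1] b • (partialHom R i)^[ij.2] y) := by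
        rw [eq_sub_iff_add_eq]
        simpa using hleib.symm
      rw [hb', sub_eq_add_neg]
      refine (IsUltrametricDist.norm_add_le_max _ _).trans (max_le (hsec k f) ?_)
      rw [norm_neg]
      refine IsUltrametricDist.norm_sum_le_of_forall_le_of_nonneg hB0 fun ij hij => ?_
      obtain ⟨hne, hmem⟩ := Finset.mem_erase.1 hij
      have hk : ij.1 + ij.2 = k := Finset.HasAntidiagonal.mem_antidiagonal.1 hmem
      have hlt : ij.2 < k := by
        refine lt_of_le_of_ne (by omega) fun h => hne (Prod.ext ?_ h)
        change ij.1 = 0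
        omega
      have hch : ‖(k.factorial : K)‖ = ‖(k.choose ij.1 : K)‖ * ‖(ij.1.factorial : K)‖ *
          ‖(ij.2.factorial : K)‖ := by
        rw [← norm_mul, ← norm_mul]
        have h := Nat.add_choose_mul_factorial_mul_factorial ij.1 ij.2
        rw [hk] at h
        rw [← h, Nat.choose_symm_of_eq_add hk.symm]
        push_cast
        rfl
      rw [nsmul_eq_mul, smul_eq_mul, norm_mul, norm_mul, norm_natCast]
      calc _ ≤ ‖(k.choose ij.1 : K)‖ * ((‖(ij.1.factorial : K)‖ * (R.1 i : ℝ)⁻¹ ^ ij.1 * ‖b‖) *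
            (‖(ij.2.factorial : K)‖ * (R.1 i : ℝ)⁻¹ ^ ij.2 * ‖y‖)) :=
            mul_le_mul_of_nonneg_left (mul_le_mul (hsec _ g) (ih _ hlt) (norm_nonneg _)
              (by positivity)) (norm_nonneg _)
        _ = B := by
            rw [hB, hch, ← hby, norm_mul, ← hk, pow_add]; ring
    rw [norm_mul] at hsum
    refine le_of_mul_le_mul_left (hsum.trans_eq ?_) hb0
    rw [hB, ← hby, norm_mul]; ring

end CompletedField

/-- The monomial `T^I` as an analytic function. -/
def monomial (K : Type*) [NontriviallyNormedField K] [IsUltrametricDist K] {n : ℕ}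
    (S : Set (Polyradius n)) (I : Fin n → ℤ) : Sections K S :=
  ⟨fun J => open Classical in if J = I then 1 else 0, by
    intro R hR
    refine tendsto_nhds_of_eventually_eq ?_
    refine (Set.finite_singleton I).subset fun J hJ => ?_
    by_contra h
    exact hJ (by
      have : J ≠ I := h
      simp [this])⟩

omit [CompleteSpace K] [Nonempty S] in
theorem coeff_monomial_self (I : Fin n → ℤ) : (monomial K S I).coeff I = 1 := if_pos rfl

omit [CompleteSpace K] [Nonempty S] in
theorem coeff_monomial_of_ne {I J : Fin n → ℤ} (h : J ≠ I) : (monomial K S I).coeff J = 0 :=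
  if_neg h

omit [CompleteSpace K] [Nonempty S] in
theorem gaussNorm_monomial_le (R : S) (I : Fin n → ℤ) :
    Sections.gaussNorm R (monomial K S I) ≤ mono R.1 I := by
  refine ciSup_le fun J => ?_
  by_cases h : J = I
  · rw [h, coeff_monomial_self, norm_one, one_mul]
  · rw [coeff_monomial_of_ne h, norm_zero, zero_mul]
    exact (mono_pos _ _).le

namespace CompletedField

theorem opNorm_iterate_partialHom (R : S) (i : Fin n) (k : ℕ) :
    opNorm (fun x : CompletedField K R => ‖x‖) (partialHom R i)^[k] =
      ‖(k.factorial : K)‖ * (R.1 i : ℝ)⁻¹ ^ k := by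
  have hr : (0 : ℝ) < R.1 i := (R.1 i).2
  have hbound := norm_iterate_partialHom_le (K := K) R i k
  have hc : 0 ≤ ‖(k.factorial : K)‖ * (R.1 i : ℝ)⁻¹ ^ k := by positivity
  refine le_antisymm (opNorm_le hc hbound) ?_
  have h1 := le_opNorm (fun x => norm_nonneg x) hc hbound
    (algebraMap _ _ (monomial K S (Pi.single i (k : ℤ))))
  simp only [iterate_partialHom_algebraMap, norm_algebraMap] at h1
  have h2 : ‖(k.factorial : K)‖ ≤ Sections.gaussNorm R
      ((Sections.partialDeriv i)^[k] (monomial K S (Pi.single i (k : ℤ)))) := by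
    refine le_trans (le_of_eq ?_) (Sections.le_gaussNorm R _ 0)
    rw [coeff_iterate_partialDeriv, zero_add, coeff_monomial_self, mul_one, mono_zero, mul_one,
      ← Finset.prod_range_add_one_eq_factorial]
    push_cast
    simp [add_comm]
  have h3 := (gaussNorm_monomial_le (K := K) R (Pi.single i (k : ℤ))).trans_eq
    (mono_single_natCast R.1 i k)
  rw [inv_pow, ← div_eq_mul_inv, div_le_iff₀ (pow_pos hr k)]
  exact h2.trans (h1.trans (mul_le_mul_of_nonneg_left h3 opNorm_nonneg))

end CompletedField

/-- The common value of `r_i |∂_i|_{F_R,sp}`, namely `inf_k |k!|^{1/k}`; it is `|p|^{1/(p-1)}` if `K`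
has residue characteristic `p > 0`, and `1` in residue characteristic `0`. -/
def factorialRate (K : Type*) [NontriviallyNormedField K] : ℝ :=
  ⨅ k : ℕ, ‖((k + 1).factorial : K)‖ ^ (1 / ((k : ℝ) + 1))

omit [CompleteSpace K] in
theorem factorialRate_pos [CharZero K] : 0 < factorialRate K := by
  obtain ⟨δ, hδ, h⟩ := exists_pow_le_norm_factorial (K := K)
  refine hδ.trans_le (le_ciInf fun k => ?_)
  have h1 := Real.rpow_le_rpow (pow_nonneg hδ.le _) (h (k + 1))
    (show (0 : ℝ) ≤ 1 / ((k : ℝ) + 1) by positivity)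
  rwa [← Real.rpow_natCast, ← Real.rpow_mul hδ.le, Nat.cast_add_one,
    mul_one_div_cancel (by positivity), Real.rpow_one] at h1

theorem specNorm_partialHom (R : S) (i : Fin n) :
    specNorm (fun x : CompletedField K R => ‖x‖) (CompletedField.partialHom R i) =
      factorialRate K * (R.1 i : ℝ)⁻¹ := by
  have hr : (0 : ℝ) ≤ (R.1 i : ℝ)⁻¹ := inv_nonneg.2 (le_of_lt (R.1 i).2)
  rw [factorialRate, Real.iInf_mul_of_nonneg hr]
  refine iInf_congr fun k => ?_
  rw [CompletedField.opNorm_iterate_partialHom, Real.mul_rpow (norm_nonneg _) (pow_nonneg hr _),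
    ← Real.rpow_natCast (_⁻¹), ← Real.rpow_mul hr, Nat.cast_add_one,
    mul_one_div_cancel (by positivity), Real.rpow_one]

end Field

/-! ### Log-convexity of Gauss norms and of the spectral norms of the derivations -/

theorem mono_interp {n : ℕ} (A B : Polyradius n) (c : ℝ) (J : Fin n → ℤ) :
    mono (interp A B c) J = mono A J ^ c * mono B J ^ (1 - c) := by
  have hA : ∀ i, (0 : ℝ) < A i := fun i => (A i).2
  have hB : ∀ i, (0 : ℝ) < B i := fun i => (B i).2
  rw [mono, mono, mono, ← Real.finsetProd_rpow _ _ fun i _ => (zpow_pos (hA i) _).le,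
    ← Real.finsetProd_rpow _ _ fun i _ => (zpow_pos (hB i) _).le, ← Finset.prod_mul_distrib]
  refine Finset.prod_congr rfl fun i _ => ?_
  change ((A i : ℝ) ^ c * (B i : ℝ) ^ (1 - c)) ^ J i = _
  simp only [mul_zpow, ← Real.rpow_intCast, ← Real.rpow_mul (hA i).le, ← Real.rpow_mul (hB i).le,
    mul_comm]

section Main

variable {K : Type*} [NontriviallyNormedField K] [IsUltrametricDist K] [CompleteSpace K] {n : ℕ}
  {S : Set (Polyradius n)} [Nonempty S]

/-- The Hadamard three-circle inequality; for a single monomial it is an equality. -/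
theorem gaussNorm_interp_le (A B C : S) {c : ℝ} (hc : c ∈ Set.Icc (0 : ℝ) 1)
    (hC : C.1 = interp A.1 B.1 c) (f : Sections K S) :
    Sections.gaussNorm C f ≤ Sections.gaussNorm A f ^ c * Sections.gaussNorm B f ^ (1 - c) := by
  have hc' : 0 ≤ 1 - c := sub_nonneg.2 hc.2
  refine ciSup_le fun J => ?_
  have hf := norm_nonneg (f.coeff J)
  have hA := mul_nonneg hf (mono_pos A.1 J).le
  have hB := mul_nonneg hf (mono_pos B.1 J).le
  calc ‖f.coeff J‖ * mono C.1 J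
      = (‖f.coeff J‖ * mono A.1 J) ^ c * (‖f.coeff J‖ * mono B.1 J) ^ (1 - c) := by
        rw [Real.mul_rpow hf (mono_pos _ _).le, Real.mul_rpow hf (mono_pos _ _).le, hC, mono_interp]
        have : ‖f.coeff J‖ = ‖f.coeff J‖ ^ c * ‖f.coeff J‖ ^ (1 - c) := by
          rw [← Real.rpow_add_of_nonneg hf hc.1 hc', add_sub_cancel, Real.rpow_one]
        nth_rewrite 1 [this]
        ring
    _ ≤ _ := mul_le_mul (Real.rpow_le_rpow hA (Sections.le_gaussNorm A f J) hc.1)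
        (Real.rpow_le_rpow hB (Sections.le_gaussNorm B f J) hc') (Real.rpow_nonneg hB _)
        (Real.rpow_nonneg (Sections.gaussNorm_nonneg A f) _)

/-- The spectral norm of `∂_i` on `F_R` is exactly log-linear in `R`. -/
theorem specNorm_partialHom_interp (A B C : S) {c : ℝ} (hC : C.1 = interp A.1 B.1 c) (i : Fin n)
    (hK : 0 < factorialRate K) :
    specNorm (fun x : CompletedField K C => ‖x‖) (CompletedField.partialHom C i) =
      specNorm (fun x : CompletedField K A => ‖x‖) (CompletedField.partialHom A i) ^ c *
        specNorm (fun x : CompletedField K B => ‖x‖) (CompletedField.partialHom B i) ^ (1 - c) := by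
  have hA : (0 : ℝ) < A.1 i := (A.1 i).2
  have hB : (0 : ℝ) < B.1 i := (B.1 i).2
  have hCi : (C.1 i : ℝ) = (A.1 i : ℝ) ^ c * (B.1 i : ℝ) ^ (1 - c) := by rw [hC]; rfl
  have hω : factorialRate K = factorialRate K ^ c * factorialRate K ^ (1 - c) := by
    rw [← Real.rpow_add hK, add_sub_cancel, Real.rpow_one]
  rw [specNorm_partialHom, specNorm_partialHom, specNorm_partialHom, hCi,
    Real.mul_rpow hK.le (inv_nonneg.2 hA.le), Real.mul_rpow hK.le (inv_nonneg.2 hB.le), mul_inv,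
    Real.inv_rpow hA.le, Real.inv_rpow hB.le]
  nth_rewrite 1 [hω]
  ring

/-! ### Supremum norms over ultrametric fields -/

section SupNorm

variable {F V ι : Type*} [NormedField F] [AddCommGroup V] [Module F V] [Fintype ι]
  (b : Module.Basis ι F V)

theorem supNorm_nonneg (x : V) : 0 ≤ supNorm b x := norm_nonneg _

theorem supNorm_smul (a : F) (x : V) : supNorm b (a • x) = ‖a‖ * supNorm b x := by
  simp only [supNorm, map_smul, norm_smul]

theorem norm_equivFun_le_supNorm (x : V) (i : ι) : ‖b.equivFun x i‖ ≤ supNorm b x :=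
  norm_le_pi_norm (b.equivFun x) i

theorem exists_norm_apply_le_supNorm (φ : V →ₗ[F] F) :
    ∃ c : ℝ, 0 ≤ c ∧ ∀ x, ‖φ x‖ ≤ c * supNorm b x := by
  refine ⟨∑ i, ‖φ (b i)‖, Finset.sum_nonneg fun _ _ => norm_nonneg _, fun x => ?_⟩
  have hx : φ x = ∑ i, b.equivFun x i * φ (b i) := by
    conv_lhs => rw [← b.sum_equivFun x, map_sum]
    simp only [map_smul, smul_eq_mul]
  rw [hx, Finset.sum_mul]
  refine (norm_sum_le _ _).trans (Finset.sum_le_sum fun i _ => ?_)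
  rw [norm_mul, mul_comm]
  exact mul_le_mul_of_nonneg_left (norm_equivFun_le_supNorm b x i) (norm_nonneg _)

variable [IsUltrametricDist F]

theorem supNorm_sum_le {κ : Type*} (s : Finset κ) (v : κ → V) {B : ℝ} (hB : 0 ≤ B)
    (h : ∀ j ∈ s, supNorm b (v j) ≤ B) : supNorm b (∑ j ∈ s, v j) ≤ B := by
  rw [supNorm, map_sum]
  exact IsUltrametricDist.norm_sum_le_of_forall_le_of_nonneg hB h

theorem supNorm_nsmul_le (m : ℕ) (x : V) : supNorm b (m • x) ≤ supNorm b x := by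
  have := supNorm_sum_le b (Finset.range m) (fun _ => x) (supNorm_nonneg b x) fun _ _ => le_rfl
  rwa [Finset.sum_const, Finset.card_range] at this

/-- An additive operator satisfying the Leibniz rule over a bounded derivation is bounded. -/
theorem exists_supNorm_le_of_leibniz (d : F →+ F) (T : V →+ V)
    (h : ∀ a v, T (a • v) = d a • v + a • T v) {r : ℝ} (hr : 0 ≤ r) (hd : ∀ a, ‖d a‖ ≤ r * ‖a‖) :
    ∃ c : ℝ, 0 ≤ c ∧ ∀ x, supNorm b (T x) ≤ c * supNorm b x := by
  have h0 : 0 ≤ ∑ i, (r * supNorm b (b i) + supNorm b (T (b i))) :=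
    Finset.sum_nonneg fun i _ =>
      add_nonneg (mul_nonneg hr (supNorm_nonneg _ _)) (supNorm_nonneg _ _)
  have hadd : ∀ x y : V, supNorm b (x + y) ≤ supNorm b x + supNorm b y := fun x y => by
    simp only [supNorm, map_add]
    exact norm_add_le _ _
  refine ⟨_, h0, fun x => ?_⟩
  conv_lhs => rw [← b.sum_equivFun x, map_sum]
  refine supNorm_sum_le b _ _ (mul_nonneg h0 (supNorm_nonneg b x)) fun i hi => ?_
  have hx := norm_equivFun_le_supNorm b x i
  rw [h]
  calc _ ≤ r * ‖b.equivFun x i‖ * supNorm b (b i) + ‖b.equivFun x i‖ * supNorm b (T (b i)) := by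
        refine (hadd _ _).trans ?_
        rw [supNorm_smul, supNorm_smul]
        gcongr
        · exact supNorm_nonneg _ _
        · exact hd _
    _ = (r * supNorm b (b i) + supNorm b (T (b i))) * ‖b.equivFun x i‖ := by ring
    _ ≤ _ := by
        refine mul_le_mul ?_ hx (norm_nonneg _) h0
        exact Finset.single_le_sum (f := fun i => r * supNorm b (b i) + supNorm b (T (b i)))
          (fun i _ => add_nonneg (mul_nonneg hr (supNorm_nonneg _ _)) (supNorm_nonneg _ _)) hi

end SupNorm

/-! ### Growth of the connection in a dual basis -/

/-- Dual basis lemma for finite projective modules. -/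
theorem exists_dual_basis (Γ M : Type*) [CommRing Γ] [AddCommGroup M] [Module Γ M]
    [Module.Finite Γ M] [Module.Projective Γ M] :
    ∃ (q : ℕ) (m : Fin q → M) (l : Fin q → M →ₗ[Γ] Γ), ∀ x, ∑ j, l j x • m j = x := by
  obtain ⟨q, f, g, -, -, hfg⟩ := Module.Finite.exists_comp_eq_id_of_projective Γ M
  refine ⟨q, fun j => f (Pi.single j 1), fun j => LinearMap.proj j ∘ₗ g, fun x => ?_⟩
  conv_rhs => rw [← LinearMap.id_apply (R := Γ) x, ← hfg, LinearMap.comp_apply,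
    pi_eq_sum_univ' (g x), map_sum]
  refine Finset.sum_congr rfl fun j _ => ?_
  rw [map_smul]
  rfl

namespace IntegrableConnection

variable {M : Type*} [AddCommGroup M] [Module (Sections K S) M] (E : IntegrableConnection K S M)

theorem baseChange_tmul (R : S) (i : Fin n) (a : CompletedField K R) (m : M) :
    E.baseChange R i (a ⊗ₜ m) = CompletedField.partialHom R i a ⊗ₜ m + a ⊗ₜ E.D i m := rfl

theorem baseChange_smul (R : S) (i : Fin n) (a : CompletedField K R)
    (v : CompletedField K R ⊗[Sections K S] M) :
    E.baseChange R i (a • v) = CompletedField.partialHom R i a • v + a • E.baseChange R i v := by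
  induction v with
  | zero => simp
  | tmul x m =>
    simp only [TensorProduct.smul_tmul', smul_eq_mul, baseChange_tmul, smul_add,
      CompletedField.partialHom_mul, TensorProduct.add_tmul, mul_comm x]
    abel
  | add v w hv hw => simp only [smul_add, map_add, hv, hw]; abel

theorem iterate_baseChange_one_tmul (R : S) (i : Fin n) (k : ℕ) (m : M) :
    (E.baseChange R i)^[k] (1 ⊗ₜ m) = 1 ⊗ₜ (E.D i)^[k] m := by
  have h1 : CompletedField.partialHom (K := K) R i 1 = 0 := by
    simpa using CompletedField.partialHom_mul (K := K) R i 1 1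
  induction k generalizing m with
  | zero => rfl
  | succ k ih => rw [Function.iterate_succ_apply, baseChange_tmul, h1, TensorProduct.zero_tmul,
      zero_add, ih, Function.iterate_succ_apply]

/-- The extension of a functional `M → Γ(A_K(S), 𝒪)` to an `F_R`-linear functional on
`F_R ⊗ M`. -/
def functionalExtension (R : S) (l : M →ₗ[Sections K S] Sections K S) :
    CompletedField K R ⊗[Sections K S] M →ₗ[CompletedField K R] CompletedField K R :=
  (TensorProduct.AlgebraTensorModule.rid (Sections K S) (CompletedField K R)
    (CompletedField K R)).toLinearMap ∘ₗ l.baseChange (CompletedField K R)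

theorem functionalExtension_tmul (R : S) (l : M →ₗ[Sections K S] Sections K S)
    (a : CompletedField K R) (m : M) :
    functionalExtension R l (a ⊗ₜ m) = l m • a := by
  simp [functionalExtension]

theorem norm_functionalExtension_one_tmul (R : S) (l : M →ₗ[Sections K S] Sections K S) (m : M) :
    ‖functionalExtension R l ((1 : CompletedField K R) ⊗ₜ m)‖ = Sections.gaussNorm R (l m) := by
  rw [functionalExtension_tmul, Algebra.smul_def, mul_one, CompletedField.norm_algebraMap]

theorem sum_functionalExtension_smul (R : S) {q : ℕ} {m : Fin q → M}
    {l : Fin q → M →ₗ[Sections K S] Sections K S} (h : ∀ x, ∑ j, l j x • m j = x)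
    (v : CompletedField K R ⊗[Sections K S] M) :
    ∑ j, functionalExtension R (l j) v • ((1 : CompletedField K R) ⊗ₜ[Sections K S] m j) = v := by
  induction v with
  | zero => simp
  | tmul a x =>
    conv_rhs => rw [← h x, TensorProduct.tmul_sum]
    refine Finset.sum_congr rfl fun j _ => ?_
    rw [functionalExtension_tmul, TensorProduct.smul_tmul', smul_eq_mul, mul_one,
      TensorProduct.tmul_smul, TensorProduct.smul_tmul']
  | add v w hv hw => simp only [map_add, add_smul, Finset.sum_add_distrib, hv, hw]

variable {ι : Type*} [Fintype ι]

/-- Growth of the connection bounds the matrix entries `l (∂_i^k m)`, which lie in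
`Γ(A_K(S), 𝒪)` and so can be compared between different `R`. -/
theorem exists_gaussNorm_le_of_hasGrowth (R : S) (i : Fin n)
    (b : Module.Basis ι (CompletedField K R) (CompletedField K R ⊗[Sections K S] M)) {θ : ℝ}
    (h : HasGrowth (supNorm b) (E.baseChange R i) θ)
    (l : M →ₗ[Sections K S] Sections K S) (m : M) :
    ∃ L : ℝ, 0 ≤ L ∧ ∀ k, Sections.gaussNorm R (l ((E.D i)^[k] m)) ≤ L * θ ^ k := by
  obtain ⟨L, hL, hgrow⟩ := h
  obtain ⟨c, hc, hφ⟩ := exists_norm_apply_le_supNorm b (functionalExtension R l)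
  refine ⟨c * L * supNorm b (1 ⊗ₜ m), mul_nonneg (mul_nonneg hc hL) (supNorm_nonneg _ _),
    fun k => ?_⟩
  rw [← norm_functionalExtension_one_tmul, ← iterate_baseChange_one_tmul]
  calc _ ≤ c * (L * θ ^ k * supNorm b (1 ⊗ₜ m)) :=
        (hφ _).trans (mul_le_mul_of_nonneg_left (hgrow k _) hc)
    _ = _ := by ring

/-- Growth bounds on the matrix entries `l s (∂_i^k (m j))` in a dual basis `(m, l)` and on the
derivation of `F_R` bound the connection: expand `∂_i^k (∑ j, a_j ⊗ m j)` by the Leibniz formula,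
whose binomial coefficients have norm at most `1`. -/
theorem hasGrowth_of_gaussNorm_le (R : S) (i : Fin n)
    (b : Module.Basis ι (CompletedField K R) (CompletedField K R ⊗[Sections K S] M)) {θ : ℝ}
    (hθ : 0 ≤ θ) {q : ℕ} {m : Fin q → M} {l : Fin q → M →ₗ[Sections K S] Sections K S}
    (h : ∀ x, ∑ j, l j x • m j = x)
    (hF : HasGrowth (fun x : CompletedField K R => ‖x‖) (CompletedField.partialHom R i) θ)
    (hM : ∀ s j, ∃ L : ℝ, 0 ≤ L ∧
      ∀ k, Sections.gaussNorm R (l s ((E.D i)^[k] (m j))) ≤ L * θ ^ k) :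
    HasGrowth (supNorm b) (E.baseChange R i) θ := by
  obtain ⟨L, hL, hF⟩ := hF
  choose N hN hM using hM
  choose c hc hφ using fun j => exists_norm_apply_le_supNorm b (functionalExtension R (l j))
  set e : Fin q → CompletedField K R ⊗[Sections K S] M := fun j => 1 ⊗ₜ m j with he
  have hp := supNorm_nonneg b
  set Q : Fin q → ℝ := fun j => ∑ s, N s j * supNorm b (e s) with hQ
  have hQ0 : ∀ j, 0 ≤ Q j := fun j => Finset.sum_nonneg fun s _ => mul_nonneg (hN s j) (hp _)
  -- `Q j` controls the iterates of the generator `1 ⊗ m j`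
  have hgen : ∀ j k, supNorm b ((E.baseChange R i)^[k] (e j)) ≤ Q j * θ ^ k := by
    intro j k
    rw [he, iterate_baseChange_one_tmul, ← sum_functionalExtension_smul R h (1 ⊗ₜ _)]
    refine supNorm_sum_le b _ _ (mul_nonneg (hQ0 j) (pow_nonneg hθ k)) fun s hs => ?_
    rw [supNorm_smul, norm_functionalExtension_one_tmul]
    calc _ ≤ N s j * θ ^ k * supNorm b (e s) := mul_le_mul_of_nonneg_right (hM s j k) (hp _)
      _ = N s j * supNorm b (e s) * θ ^ k := by ring
      _ ≤ _ := mul_le_mul_of_nonneg_right (Finset.single_le_sum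
          (f := fun s => N s j * supNorm b (e s)) (fun s _ => mul_nonneg (hN s j) (hp _)) hs)
          (pow_nonneg hθ k)
  have hcQ : 0 ≤ ∑ j, c j * Q j := Finset.sum_nonneg fun j _ => mul_nonneg (hc j) (hQ0 j)
  refine ⟨L * ∑ j, c j * Q j, mul_nonneg hL hcQ, fun k x => ?_⟩
  have hB : 0 ≤ L * (∑ j, c j * Q j) * θ ^ k * supNorm b x :=
    mul_nonneg (mul_nonneg (mul_nonneg hL hcQ) (pow_nonneg hθ k)) (hp x)
  have hsum : (E.baseChange R i)^[k] x =
      ∑ j, (E.baseChange R i)^[k] (functionalExtension R (l j) x • e j) := by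
    conv_lhs => rw [← sum_functionalExtension_smul R h x]
    clear hB
    induction k with
    | zero => rfl
    | succ k ih => simp only [Function.iterate_succ_apply', ih, map_sum]
  rw [hsum]
  refine supNorm_sum_le b _ _ hB fun j hj => ?_
  rw [iterate_smul_eq_sum (CompletedField.partialHom R i).toAddMonoidHom (E.baseChange R i)
    (E.baseChange_smul R i)]
  refine supNorm_sum_le b _ _ hB fun ij hij => ?_
  have hk : ij.1 + ij.2 = k := Finset.HasAntidiagonal.mem_antidiagonal.1 hij
  refine (supNorm_nsmul_le b _ _).trans ?_
  rw [supNorm_smul]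
  calc _ ≤ L * θ ^ ij.1 * (c j * supNorm b x) * (Q j * θ ^ ij.2) :=
        mul_le_mul ((hF _ _).trans (mul_le_mul_of_nonneg_left (hφ j x)
          (mul_nonneg hL (pow_nonneg hθ _)))) (hgen j _) (hp _)
          (mul_nonneg (mul_nonneg hL (pow_nonneg hθ _)) (mul_nonneg (hc j) (hp x)))
    _ = L * (c j * Q j) * θ ^ k * supNorm b x := by rw [← hk, pow_add]; ring
    _ ≤ _ := by
        refine mul_le_mul_of_nonneg_right (mul_le_mul_of_nonneg_right
          (mul_le_mul_of_nonneg_left ?_ hL) (pow_nonneg hθ k)) (hp x)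
        exact Finset.single_le_sum (f := fun j => c j * Q j)
          (fun j _ => mul_nonneg (hc j) (hQ0 j)) hj

/-! ### The generic radius of convergence -/

variable [Module.Finite (Sections K S) M]

theorem one_le_scale (R : S) : 1 ≤ E.scale R := le_max_left _ _

variable [CharZero K]

theorem specNorm_partialHom_pos (R : S) (i : Fin n) :
    0 < specNorm (fun x : CompletedField K R => ‖x‖) (CompletedField.partialHom R i) := by
  rw [specNorm_partialHom]
  exact mul_pos factorialRate_pos (inv_pos.2 (R.1 i).2)

theorem specNorm_baseChange_le (R : S) (i : Fin n) :
    specNorm (supNorm (Module.finBasis (CompletedField K R)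
        (CompletedField K R ⊗[Sections K S] M))) (E.baseChange R i) ≤
      E.scale R * specNorm (fun x : CompletedField K R => ‖x‖) (CompletedField.partialHom R i) := by
  rw [← div_le_iff₀ (specNorm_partialHom_pos R i)]
  refine le_trans ?_ (le_max_right _ _)
  exact le_ciSup (f := fun i : Fin n => specNorm (supNorm (Module.finBasis (CompletedField K R)
    (CompletedField K R ⊗[Sections K S] M))) (E.baseChange R i) /
      specNorm (fun x : CompletedField K R => ‖x‖) (CompletedField.partialHom R i))
    (Set.finite_range _).bddAbove i

/-- The matrix entries of `∂_i^k` grow at most like the `k`-th power of any number larger than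
`scale R * |∂_i|_{F_R,sp}`. -/
theorem exists_gaussNorm_le_of_scale_lt (R : S) (i : Fin n) {ρ : ℝ} (hρ : E.scale R < ρ)
    (l : M →ₗ[Sections K S] Sections K S) (m : M) :
    ∃ L : ℝ, 0 ≤ L ∧ ∀ k, Sections.gaussNorm R (l ((E.D i)^[k] m)) ≤
      L * (ρ * specNorm (fun x : CompletedField K R => ‖x‖)
        (CompletedField.partialHom R i)) ^ k := by
  have hpos := specNorm_partialHom_pos (K := K) R i
  set b := Module.finBasis (CompletedField K R) (CompletedField K R ⊗[Sections K S] M)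
  have hr : (0 : ℝ) ≤ (R.1 i : ℝ)⁻¹ := inv_nonneg.2 (le_of_lt (R.1 i).2)
  obtain ⟨c, hc, hbound⟩ := exists_supNorm_le_of_leibniz b
    (CompletedField.partialHom R i).toAddMonoidHom (E.baseChange R i) (E.baseChange_smul R i) hr
    fun a => by simpa using CompletedField.norm_iterate_partialHom_le R i 1 a
  exact E.exists_gaussNorm_le_of_hasGrowth R i b
    (hasGrowth_of_specNorm_lt (supNorm_nonneg b) hc hbound ((E.specNorm_baseChange_le R i).trans_lt
      (mul_lt_mul_of_pos_right hρ hpos))) l m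

/-- The scale, which is the inverse of the generic radius, is log-convex. -/
theorem scale_interp_le [Module.Projective (Sections K S) M] (A B C : S) {c : ℝ}
    (hc : c ∈ Set.Icc (0 : ℝ) 1) (hC : C.1 = interp A.1 B.1 c) :
    E.scale C ≤ E.scale A ^ c * E.scale B ^ (1 - c) := by
  have hc' : 0 ≤ 1 - c := sub_nonneg.2 hc.2
  have hA := zero_lt_one.trans_le (E.one_le_scale A)
  have hB := zero_lt_one.trans_le (E.one_le_scale B)
  set X : ℝ := E.scale A ^ c * E.scale B ^ (1 - c) with hXdef
  have hX : 1 ≤ X :=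
    one_le_mul_of_one_le_of_one_le (Real.one_le_rpow (E.one_le_scale A) hc.1)
      (Real.one_le_rpow (E.one_le_scale B) hc')
  have hX0 := zero_lt_one.trans_le hX
  refine max_le hX (Real.iSup_le (fun i => ?_) hX0.le)
  have hposA := specNorm_partialHom_pos (K := K) A i
  have hposB := specNorm_partialHom_pos (K := K) B i
  have hposC := specNorm_partialHom_pos (K := K) C i
  have hint := specNorm_partialHom_interp (K := K) A B C hC i factorialRate_pos
  refine le_of_forall_gt_imp_ge_of_dense fun y hy => ?_
  have hy0 : 0 < y := hX0.trans hy
  rw [div_le_iff₀ hposC]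
  -- Both scales are enlarged by the same factor `t > 1`, so that the bound becomes `t * X = y`.
  set t : ℝ := y / X with ht
  have ht1 : 1 < t := (one_lt_div hX0).2 hy
  have ht0 : 0 < t := zero_lt_one.trans ht1
  have hty : (t * E.scale A) ^ c * (t * E.scale B) ^ (1 - c) = y := by
    rw [Real.mul_rpow ht0.le hA.le, Real.mul_rpow ht0.le hB.le, mul_mul_mul_comm,
      ← Real.rpow_add ht0, add_sub_cancel, Real.rpow_one, ht, div_mul_cancel₀ _ hX0.ne']
  obtain ⟨q, m, l, hml⟩ := exists_dual_basis (Sections K S) M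
  refine specNorm_le_of_hasGrowth (supNorm_nonneg _) (mul_pos hy0 hposC).le
    (E.hasGrowth_of_gaussNorm_le C i _ (mul_pos hy0 hposC).le hml ?_ fun s j => ?_)
  · refine hasGrowth_of_specNorm_lt (fun x => norm_nonneg x)
      (inv_nonneg.2 (le_of_lt (C.1 i).2) : (0 : ℝ) ≤ (C.1 i : ℝ)⁻¹)
      (fun x => by simpa using CompletedField.norm_iterate_partialHom_le C i 1 x)
      (lt_mul_of_one_lt_left hposC (hX.trans_lt hy))
  · obtain ⟨LA, hLA, hgA⟩ := E.exists_gaussNorm_le_of_scale_lt A i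
      (lt_mul_of_one_lt_left hA ht1) (l s) (m j)
    obtain ⟨LB, hLB, hgB⟩ := E.exists_gaussNorm_le_of_scale_lt B i
      (lt_mul_of_one_lt_left hB ht1) (l s) (m j)
    refine ⟨LA ^ c * LB ^ (1 - c), mul_nonneg (Real.rpow_nonneg hLA _) (Real.rpow_nonneg hLB _),
      fun k => (gaussNorm_interp_le A B C hc hC _).trans ?_⟩
    have hA0 := Sections.gaussNorm_nonneg A (l s ((E.D i)^[k] (m j)))
    have hB0 := Sections.gaussNorm_nonneg B (l s ((E.D i)^[k] (m j)))
    refine (mul_le_mul (Real.rpow_le_rpow hA0 (hgA k) hc.1) (Real.rpow_le_rpow hB0 (hgB k) hc')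
      (Real.rpow_nonneg hB0 _) (Real.rpow_nonneg (hA0.trans (hgA k)) _)).trans_eq ?_
    have htA := mul_pos ht0 hA
    have htB := mul_pos ht0 hB
    have hθA := mul_pos htA hposA
    have hθB := mul_pos htB hposB
    rw [Real.mul_rpow hLA (pow_nonneg hθA.le k), Real.mul_rpow hLB (pow_nonneg hθB.le k),
      mul_mul_mul_comm, ← Real.rpow_pow_comm hθA.le, ← Real.rpow_pow_comm hθB.le, ← mul_pow,
      Real.mul_rpow htA.le hposA.le, Real.mul_rpow htB.le hposB.le, mul_mul_mul_comm, hty, ← hint]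

end IntegrableConnection
end Main

end GenericRadius

end

theorem propositionP {K : Type*} [NontriviallyNormedField K] [IsUltrametricDist K]
    [CompleteSpace K] [CharZero K] {n : ℕ}
    (S : Set (GenericRadius.Polyradius n)) [Nonempty S] (hS : GenericRadius.IsLogRP S)
    {M : Type*} [AddCommGroup M] [Module (GenericRadius.Sections K S) M]
    [Module.Finite (GenericRadius.Sections K S) M]
    [Module.Projective (GenericRadius.Sections K S) M]
    (E : GenericRadius.IntegrableConnection K S M)
    (A B : S) (c : ℝ) (hc : c ∈ Set.Icc (0 : ℝ) 1) :
    E.genericRadius A ^ c * E.genericRadius B ^ (1 - c) ≤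
      E.genericRadius ⟨GenericRadius.interp A B c, hS.interp_mem A.2 B.2 hc⟩ := by
  have hA := zero_lt_one.trans_le (E.one_le_scale A)
  have hB := zero_lt_one.trans_le (E.one_le_scale B)
  rw [GenericRadius.IntegrableConnection.genericRadius,
    GenericRadius.IntegrableConnection.genericRadius,
    GenericRadius.IntegrableConnection.genericRadius, Real.inv_rpow hA.le, Real.inv_rpow hB.le,
    ← mul_inv]
  exact inv_anti₀ (zero_lt_one.trans_le (E.one_le_scale _)) (E.scale_interp_le A B _ hc rfl)
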